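/- **Setting.** Let $\mathbb O$ be either the open unit disk $\{|z|<1\}$ or the open upper half plane $\{\operatorname{Im}z>0\}$, with boundary $\partial\mathbb O=\mathbb T$, respectively $\partial\mathbb O=\mathbb R\cup\{\infty\}$, in the Riemann sphere. Put $\alpha_0=0$, respectively $\alpha_0=i$. For $\alpha\in\mathbb O$ let $\varpi^*_\alpha(z)=z-\alpha$, $\varpi_\alpha(z)=1-\overline\alpha z$ (disk) or $z-\overline\alpha$ (half plane), $z_\alpha=-|\alpha|/\alpha$ (disk) or $|1+\alpha^2|/(1+\alpha^2)$ (half plane), with $z_{\alpha_0}=1$, and $\zeta_\alpha=z_\alpha\varpi^*_\alpha/\varpi_\alpha$. For a rational function $g$ let $g_*(z)=\overline{g(\hat z)}$ with $\hat z=1/\overline z$ (disk) or $\hat z=\overline z$ (half plane). Let $(\alpha_n)_{n\ge1}$ be a sequence in $\mathbb O$; the subscript $n\ge0$ abbreviates the subscript $\alpha_n$ in $\varpi,\varpi^*,z,\zeta$. Let $B_n=\zeta_1\cdots\zeta_n$, $B_0=1$; for the functions with index $n$ below, $g_n^*=B_n\,g_{n*}$. **Measure and Schur function.** Let $\mu$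 be a Borel probability measure on $\partial\mathbb O$, $D(t,z)=\frac{\zeta_0(t)+\zeta_0(z)}{\zeta_0(t)-\zeta_0(z)}$, $F(z)=\int D(t,z)\,d\mu(t)$ for $z\in\mathbb O$, and let $f=\frac1{\zeta_0}\frac{F-1}{F+1}$ be its Schur function (analytic in $\mathbb O$, $|f|\le1$, with the removable singularity at $\alpha_0$ filled). **Wall rational functions.** Let $f_0=f$, $\gamma_n=f_n(\alpha_{n+1})$, $f_{n+1}=\frac1{\zeta_{n+1}}\frac{f_n-\gamma_n}{1-\overline{\gamma_n}f_n}$ (removable singularity filled), stopping at the first index $N$ for which $|f_N|<1$ fails somewhere in $\mathbb O$ ($N=\infty$ if there is none). Let $R_0=\gamma_0$, $S_0=1$ and, for $1\le n\le N$ ($n$ finite), $R_n=R_{n-1}+\gamma_n\zeta_nS^*_{n-1}$, $S_n=S_{n-1}+\gamma_n\zeta_nR^*_{n-1}$. Let $\Upsilon_n=\prod_{k=0}^n(1-|\gamma_k|^2)$. **Orthogonal and second kind rational functions.** Let $(\Phi_n)_{n=0}^N$ be the orthonormalization of $(B_n)_{n=0}^N$ in $L^2(\mu)$ ($\Phi_n\in\operatorname{span}\{B_0,\dots,B_n\}$,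 $\int\overline{\Phi_m}\Phi_n\,d\mu=\delta_{mn}$), with the unimodular factors fixed by $\Phi_0=1$ and $$\frac{\varpi_n(\alpha_{n-1})\,\Phi_n^*(\alpha_{n-1})}{\varpi_{n-1}(\alpha_{n-1})\,\Phi_{n-1}^*(\alpha_{n-1})}>0\qquad(1\le n\le N).$$ Let $(\Psi_n)_{n=0}^N$ be the rational functions given by $\Psi_0=1$ and $\Psi_n(z)=\int D(t,z)\,(\Phi_n(t)-\Phi_n(z))\,d\mu(t)$, $z\in\mathbb O$, for $n\ge1$. **Proposition.** Let $\kappa_n=\bigl(\Upsilon_{n-1}\,\varpi_0(\alpha_0)/\varpi_n(\alpha_n)\bigr)^{1/2}$. For every integer $n$ with $1\le n<N+1$, the following identities between rational functions hold: $$R_{n-1}=\frac{\kappa_n}{2}\frac{\varpi_n}{\varpi_0^*}(\Psi_n^*-\Phi_n^*),\qquad R_{n-1}^*=\frac{\kappa_n}{2z_n}\frac{\varpi_n}{\varpi_0}(\Psi_n-\Phi_n),$$ $$S_{n-1}=\frac{\kappa_n}{2}\frac{\varpi_n}{\varpi_0}(\Psi_n^*+\Phi_n^*),\qquad S_{n-1}^*=\frac{\kappa_n}{2z_n}\frac{\varpi_n}{\varpi_0^*}(\Psi_n+\Phi_n),$$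 and conversely $$\Phi_n=\frac{z_n}{\kappa_n}\frac{\varpi_0}{\varpi_n}(\zeta_0S_{n-1}^*-R_{n-1}^*),\qquad \Phi_n^*=\frac1{\kappa_n}\frac{\varpi_0}{\varpi_n}(S_{n-1}-\zeta_0R_{n-1}),$$ $$\Psi_n=\frac{z_n}{\kappa_n}\frac{\varpi_0}{\varpi_n}(\zeta_0S_{n-1}^*+R_{n-1}^*),\qquad \Psi_n^*=\frac1{\kappa_n}\frac{\varpi_0}{\varpi_n}(S_{n-1}+\zeta_0R_{n-1}).$$ -/

import Mathlib

open MeasureTheory Set Filter Topology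

noncomputable section

namespace WallORF

/-- The Riemann sphere carries its Borel σ-algebra. -/
instance : MeasurableSpace (OnePoint ℂ) := borel (OnePoint ℂ)

instance : BorelSpace (OnePoint ℂ) := ⟨rfl⟩

/-- The two settings treated simultaneously: the unit disk and the upper half plane. -/
inductive Region
  | disk
  | halfPlane

/-- The open set `𝕆`: the open unit disk or the open upper half plane. -/
def domain : Region → Set ℂ
  | .disk => {z | ‖z‖ < 1}
  | .halfPlane => {z | 0 < z.im}

/-- The boundary `∂𝕆` in the Riemann sphere: the unit circle or the extended real line. -/
def boundary : Region → Set (OnePoint ℂ)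
  | .disk => (fun z : ℂ => (z : OnePoint ℂ)) '' {z | ‖z‖ = 1}
  | .halfPlane => insert OnePoint.infty ((fun z : ℂ => (z : OnePoint ℂ)) '' {z | z.im = 0})

/-- The base point `α₀`: `0` or `i`. -/
def basePoint : Region → ℂ
  | .disk => 0
  | .halfPlane => Complex.I

/-- Value of a rational function at a finite point (junk value `0` at a pole). -/
def val (r : RatFunc ℂ) (z : ℂ) : ℂ := r.eval (RingHom.id ℂ) z

/-- Value of a rational function at a point of the Riemann sphere; the value at `∞` is the value
at `w = 0` of the rational function `r (1 / w)`. -/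
def sphereVal (r : RatFunc ℂ) : OnePoint ℂ → ℂ
  | none => val (r.eval RatFunc.C (RatFunc.X⁻¹ : RatFunc ℂ)) 0
  | some z => val r z

/-- The substar operation `r_*(z) = conj (r (ẑ))`, where `ẑ = 1 / conj z` in the disk case and
`ẑ = conj z` in the half plane case: conjugate the coefficients of `r`, and replace the variable
by `1 / z`, respectively by `z`. -/
def substar : Region → RatFunc ℂ → RatFunc ℂ
  | .disk, r => r.eval (RatFunc.C.comp (starRingEnd ℂ)) (RatFunc.X⁻¹ : RatFunc ℂ)
  | .halfPlane, r => r.eval (RatFunc.C.comp (starRingEnd ℂ)) (RatFunc.X : RatFunc ℂ)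

open Classical in
/-- The unimodular constant `z_α`, with `z_{α₀} = 1`. -/
def unimod (d : Region) (a : ℂ) : ℂ :=
  if a = basePoint d then 1
  else match d with
    | .disk => -((‖a‖ : ℝ) : ℂ) / a
    | .halfPlane => ((‖1 + a ^ 2‖ : ℝ) : ℂ) / (1 + a ^ 2)

/-- `ϖ_α(z)`: `1 - conj α * z` or `z - conj α`. -/
def varpi : Region → ℂ → RatFunc ℂ
  | .disk, a => 1 - RatFunc.C (starRingEnd ℂ a) * RatFunc.X
  | .halfPlane, a => RatFunc.X - RatFunc.C (starRingEnd ℂ a)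

/-- `ϖ*_α(z) = z - α`. -/
def varpiStar (a : ℂ) : RatFunc ℂ := RatFunc.X - RatFunc.C a

/-- The Möbius transformation `ζ_α = z_α ϖ*_α / ϖ_α`. -/
def zeta (d : Region) (a : ℂ) : RatFunc ℂ :=
  RatFunc.C (unimod d a) * (varpiStar a / varpi d a)

/-- The Blaschke products `B_n = ζ_1 ⋯ ζ_n`, `B_0 = 1`. -/
def blaschke (d : Region) (α : ℕ → ℂ) (n : ℕ) : RatFunc ℂ :=
  ∏ k ∈ Finset.Icc 1 n, zeta d (α k)

/-- The superstar operation of index `n`: `r ↦ r^* = B_n r_*`. -/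
def supstar (d : Region) (α : ℕ → ℂ) (n : ℕ) (r : RatFunc ℂ) : RatFunc ℂ :=
  blaschke d α n * substar d r

/-- The kernel `D(t,z) = (ζ_0(t) + ζ_0(z)) / (ζ_0(t) - ζ_0(z))`. -/
def kernelD (d : Region) (t : OnePoint ℂ) (z : ℂ) : ℂ :=
  (sphereVal (zeta d (basePoint d)) t + val (zeta d (basePoint d)) z) /
    (sphereVal (zeta d (basePoint d)) t - val (zeta d (basePoint d)) z)

/-- The C-function `F(z;dμ) = ∫ D(t,z) dμ(t)`. -/
def cFun (d : Region) (μ : Measure (boundary d)) (z : ℂ) : ℂ :=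
  ∫ t : boundary d, kernelD d (t : OnePoint ℂ) z ∂μ

/-- Schur functions: analytic on `𝕆` and bounded by `1` there. -/
def IsSchur (d : Region) (f : ℂ → ℂ) : Prop :=
  DifferentiableOn ℂ f (domain d) ∧ ∀ z ∈ domain d, ‖f z‖ ≤ 1

/-- `f` is the Schur function `f(·;dμ) = (1 / ζ_0) (F - 1) / (F + 1)` of the measure `μ`
(the singularity at `α₀` is removable: `f` is analytic on all of `𝕆`). -/
def IsSchurFunOf (d : Region) (μ : Measure (boundary d)) (f : ℂ → ℂ) : Prop :=
  IsSchur d f ∧ ∀ z ∈ domain d, z ≠ basePoint d →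
    f z = 1 / val (zeta d (basePoint d)) z * ((cFun d μ z - 1) / (cFun d μ z + 1))

/-- One step of the Nevanlinna–Pick algorithm at the point `a`,
`f ↦ (1 / ζ_a) (f - f(a)) / (1 - conj (f(a)) f)`, with its removable singularity at `a` filled. -/
def npStep (d : Region) (a : ℂ) (f : ℂ → ℂ) : ℂ → ℂ :=
  let g : ℂ → ℂ := fun z =>
    1 / val (zeta d a) z * ((f z - f a) / (1 - starRingEnd ℂ (f a) * f z))
  Function.update g a (limUnder (𝓝[≠] a) g)

/-- The `α`-iterates `f_n` of `f`. -/
def npIterate (d : Region) (α : ℕ → ℂ) (f : ℂ → ℂ) : ℕ → ℂ → ℂ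
  | 0 => f
  | n + 1 => npStep d (α (n + 1)) (npIterate d α f n)

/-- The `α`-parameters `γ_n = f_n(α_{n+1})` of `f`. -/
def npParam (d : Region) (α : ℕ → ℂ) (f : ℂ → ℂ) (n : ℕ) : ℂ :=
  npIterate d α f n (α (n + 1))

/-- The index `N ∈ {0, 1, …, ∞}` at which the algorithm terminates: the first `n` for which `f_n`
is not strictly bounded by `1` on `𝕆`, and `∞` if there is none. The iterates and parameters of
larger index are meaningless. -/
def npLength (d : Region) (α : ℕ → ℂ) (f : ℂ → ℂ) : ℕ∞ :=
  ⨅ n ∈ {n : ℕ | ¬ ∀ z ∈ domain d, ‖npIterate d α f n z‖ < 1}, (n : ℕ∞)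

/-- The pair `(R_n, S_n)` of Wall rational functions:
`R_0 = γ_0`, `S_0 = 1`, `R_n = R_{n-1} + γ_n ζ_n S_{n-1}^*`, `S_n = S_{n-1} + γ_n ζ_n R_{n-1}^*`. -/
def wall (d : Region) (α : ℕ → ℂ) (f : ℂ → ℂ) : ℕ → RatFunc ℂ × RatFunc ℂ
  | 0 => (RatFunc.C (npParam d α f 0), 1)
  | n + 1 =>
    let R := (wall d α f n).1
    let S := (wall d α f n).2
    (R + RatFunc.C (npParam d α f (n + 1)) * zeta d (α (n + 1)) * supstar d α n S,
     S + RatFunc.C (npParam d α f (n + 1)) * zeta d (α (n + 1)) * supstar d α n R)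

/-- The Wall rational function `R_n`. -/
def wallR (d : Region) (α : ℕ → ℂ) (f : ℂ → ℂ) (n : ℕ) : RatFunc ℂ := (wall d α f n).1

/-- The Wall rational function `S_n`. -/
def wallS (d : Region) (α : ℕ → ℂ) (f : ℂ → ℂ) (n : ℕ) : RatFunc ℂ := (wall d α f n).2

/-- `Υ_n = ∏_{k=0}^n (1 - |γ_k|²)`. -/
def upsilon (d : Region) (α : ℕ → ℂ) (f : ℂ → ℂ) (n : ℕ) : ℝ :=
  ∏ k ∈ Finset.range (n + 1), (1 - ‖npParam d α f k‖ ^ 2)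

/-- `κ_n = (Υ_{n-1} ϖ_0(α_0) / ϖ_n(α_n))^{1/2}`, for `n ≥ 1`. The quotient `ϖ_0(α_0) / ϖ_n(α_n)` is
a positive real number: it is `1 / (1 - |α_n|²)`, respectively `1 / Im α_n`. -/
def kappa (d : Region) (α : ℕ → ℂ) (f : ℂ → ℂ) (n : ℕ) : ℝ :=
  Real.sqrt (upsilon d α f (n - 1) *
    (val (varpi d (α 0)) (α 0) / val (varpi d (α n)) (α n)).re)

/-- `(Φ_n)_{n=0}^N` is the sequence of orthogonal rational functions of `μ` and `α`: the
orthonormalization in `L²(μ)` of `B_0, B_1, …`, normalized by `Φ_0 = 1` and by the positivity of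
`e_n = Φ_n^*(α_{n-1}) ϖ_n(α_{n-1}) / (ϖ_{n-1}(α_{n-1}) Φ_{n-1}^*(α_{n-1}))`.

This fixes the unimodular factor left free by orthonormality, and it is the normalization for which
`Φ_n^* = e_n (ϖ_{n-1} / ϖ_n) (Λ_n z_n conj(z_{n-1}) ζ_{n-1} Φ_{n-1} + Φ_{n-1}^*)` holds with `e_n > 0`
(at the point `α_{n-1}` the factor `ζ_{n-1}` vanishes, which gives the above formula for `e_n`). -/
structure IsORF (d : Region) (α : ℕ → ℂ) (μ : Measure (boundary d)) (N : ℕ∞)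
    (Φ : ℕ → RatFunc ℂ) : Prop where
  mem_span : ∀ n : ℕ, (n : ℕ∞) ≤ N → Φ n ∈ Submodule.span ℂ (blaschke d α '' Set.Iic n)
  orthonormal : ∀ m n : ℕ, (m : ℕ∞) ≤ N → (n : ℕ∞) ≤ N →
    ∫ t : boundary d, starRingEnd ℂ (sphereVal (Φ m) t) * sphereVal (Φ n) t ∂μ =
      if m = n then 1 else 0
  zero : Φ 0 = 1
  normalized : ∀ n : ℕ, 1 ≤ n → (n : ℕ∞) ≤ N → ∃ e : ℝ, 0 < e ∧
    val (supstar d α n (Φ n)) (α (n - 1)) * val (varpi d (α n)) (α (n - 1)) =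
      e * (val (varpi d (α (n - 1))) (α (n - 1)) *
        val (supstar d α (n - 1) (Φ (n - 1))) (α (n - 1)))

/-- `(Ψ_n)_{n=0}^N` are the second kind rational functions: `Ψ_0 = 1` and
`Ψ_n(z) = ∫ D(t,z) (Φ_n(t) - Φ_n(z)) dμ(t)` for `n ≥ 1`. The rational function `Ψ_n` is determined by
its values on `𝕆`. -/
structure IsSecondKind (d : Region) (μ : Measure (boundary d)) (N : ℕ∞)
    (Φ Ψ : ℕ → RatFunc ℂ) : Prop where
  zero : Ψ 0 = 1
  integral : ∀ n : ℕ, 1 ≤ n → (n : ℕ∞) ≤ N → ∀ z ∈ domain d,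
    val (Ψ n) z = ∫ t : boundary d, kernelD d (t : OnePoint ℂ) z *
      (sphereVal (Φ n) t - val (Φ n) z) ∂μ

end WallORF

end

open WallORF

/-! The right-hand sides of the converse identities define candidates `wallPhi` and `wallPsi`. The
work is to show that they are the orthonormal and second kind functions; the identities for R, S and
their superstars then follow by solving a linear system.

Put W = ζ_0. Every ζ_a is a unimodular multiple of the Blaschke factor (W - b)/(1 - conj b W) with b
= ζ_0(a) (`zeta_eq`), so beyond a few explicit computations both regions are handled at once, with
the measure seen through the unimodular boundary values of W.

Running the Nevanlinna–Pick recursion backwards gives f = (R_m + ζ_{m+1} S_m^* f_{m+1}) / (S_m +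
ζ_{m+1} R_m^* f_{m+1}). With the determinant S_m S_m^* - R_m R_m^* = Υ_m B_m (`wall_det`), this
shows that S_m^* - f R_m^* is divisible by B_m and f S_m - R_m by B_{m+1} (`wall_interpolation`).
Inserting F = (1 + ζ_0 f)/(1 - ζ_0 f), the candidates satisfy Ψ + FΦ = 2 ζ_0 B_m h with h continuous
on 𝕆, while F Φ_* - Ψ_* extends continuously over the zeros of B_{m+1}.

The second fact identifies Ψ (`wallPsi_isSecondKindOf`). Let P be the true second kind function of
the candidate Φ. Then P_* - Ψ_* has no poles in 𝕆, which forces P - Ψ to be constant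
(`eq_C_of_substar_continuousOn`); two evaluations at α_0 show that the constant is 0 and that Φ has
mean 0. The first fact then says that the Cauchy transform of Φμ in the variable ζ_0 equals B_m h.
Its zeros can be removed one node at a time, and each removal yields orthogonality to one more B_k
(`cauchyT_conj_blaschke_mul_wallPhi`). One further step computes the norm, which is 1 by the choice
of κ (`integral_conj_wallPhi_mul_self`).

A dimension count (`IsORF.span_eq`) makes the candidate a unimodular multiple of the given Φ_{m+1}
(`exists_wallPhi_eq_smul`), and the positivity normalization at α_m makes the multiple 1
(`IsORF.eq_wallPhi`). -/

namespace WallORF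

open ComplexConjugate

/-! ### Values of rational functions away from their poles -/

open Polynomial in
/-- The rational function `r` is a quotient of polynomials whose denominator does not vanish at
`z`, and its value there is `v`. -/
def HasVal (r : RatFunc ℂ) (z v : ℂ) : Prop :=
  ∃ p q : ℂ[X], q.eval z ≠ 0 ∧ r = algebraMap _ _ p / algebraMap _ _ q ∧
    v = p.eval z / q.eval z

namespace HasVal

theorem ne_zero_of_eval {q : Polynomial ℂ} {z : ℂ} (h : q.eval z ≠ 0) :
    (algebraMap (Polynomial ℂ) (RatFunc ℂ) q) ≠ 0 := by
  intro h0
  rw [map_eq_zero_iff _ (RatFunc.algebraMap_injective ℂ)] at h0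
  simp [h0] at h

/-- The witnessing fraction need not be reduced, but the reduced denominator divides `q` and so is
nonzero at `z`. This is what lets values be computed along field operations, which fails for `val`
alone because of its junk value at poles. -/
theorem val_eq {r : RatFunc ℂ} {z v : ℂ} (h : HasVal r z v) : val r z = v := by
  obtain ⟨p, q, hq, hr, rfl⟩ := h
  have hq0 : q ≠ 0 := by rintro rfl; simp at hq
  have hd : r.denom.eval z ≠ 0 := by
    obtain ⟨c, hc⟩ := (RatFunc.denom_dvd (x := r) hq0).2 ⟨p, hr⟩
    intro h0
    rw [hc, Polynomial.eval_mul, h0, zero_mul] at hq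
    exact hq rfl
  have key : r.num * q = p * r.denom := by
    apply RatFunc.algebraMap_injective ℂ
    rw [map_mul, map_mul]
    have h1 := RatFunc.num_div_denom r
    nth_rewrite 3 [hr] at h1
    exact (div_eq_div_iff (RatFunc.algebraMap_ne_zero r.denom_ne_zero)
      (ne_zero_of_eval hq)).1 h1
  have key2 := congrArg (Polynomial.eval z) key
  rw [Polynomial.eval_mul, Polynomial.eval_mul] at key2
  have : val r z = r.num.eval z / r.denom.eval z := rfl
  rw [this, div_eq_div_iff hd hq, key2]

theorem denom_ne {r : RatFunc ℂ} {z v : ℂ} (h : HasVal r z v) : r.denom.eval z ≠ 0 := by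
  obtain ⟨p, q, hq, hr, rfl⟩ := h
  have hq0 : q ≠ 0 := by rintro rfl; simp at hq
  obtain ⟨c, hc⟩ := (RatFunc.denom_dvd (x := r) hq0).2 ⟨p, hr⟩
  intro h0
  rw [hc, Polynomial.eval_mul, h0, zero_mul] at hq
  exact hq rfl

theorem unique {r : RatFunc ℂ} {z v v' : ℂ} (h : HasVal r z v) (h' : HasVal r z v') : v = v' :=
  h.val_eq.symm.trans h'.val_eq

theorem C (c z : ℂ) : HasVal (RatFunc.C c) z c :=
  ⟨Polynomial.C c, 1, by simp, by simp, by simp⟩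

theorem one (z : ℂ) : HasVal 1 z 1 := by simpa using C 1 z

theorem zero (z : ℂ) : HasVal 0 z 0 := by simpa using C 0 z

theorem X (z : ℂ) : HasVal RatFunc.X z z :=
  ⟨Polynomial.X, 1, by simp, by simp, by simp⟩

theorem add {r s : RatFunc ℂ} {z v v' : ℂ} (h : HasVal r z v) (h' : HasVal s z v') :
    HasVal (r + s) z (v + v') := by
  obtain ⟨p, q, hq, rfl, rfl⟩ := h
  obtain ⟨p', q', hq', rfl, rfl⟩ := h'
  refine ⟨p * q' + q * p', q * q', by simp [hq, hq'], ?_, ?_⟩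
  · rw [div_add_div _ _ (ne_zero_of_eval hq) (ne_zero_of_eval hq')]
    simp
  · rw [div_add_div _ _ hq hq']
    simp

theorem mul {r s : RatFunc ℂ} {z v v' : ℂ} (h : HasVal r z v) (h' : HasVal s z v') :
    HasVal (r * s) z (v * v') := by
  obtain ⟨p, q, hq, rfl, rfl⟩ := h
  obtain ⟨p', q', hq', rfl, rfl⟩ := h'
  refine ⟨p * p', q * q', by simp [hq, hq'], ?_, ?_⟩
  · rw [div_mul_div_comm]
    simp
  · rw [div_mul_div_comm]
    simp

theorem neg {r : RatFunc ℂ} {z v : ℂ} (h : HasVal r z v) : HasVal (-r) z (-v) := by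
  simpa using (C (-1) z).mul h

theorem sub {r s : RatFunc ℂ} {z v v' : ℂ} (h : HasVal r z v) (h' : HasVal s z v') :
    HasVal (r - s) z (v - v') := by
  simpa [sub_eq_add_neg] using h.add h'.neg

theorem inv {r : RatFunc ℂ} {z v : ℂ} (h : HasVal r z v) (hv : v ≠ 0) :
    HasVal r⁻¹ z v⁻¹ := by
  obtain ⟨p, q, hq, rfl, rfl⟩ := h
  exact ⟨q, p, fun h => by simp [h] at hv, by rw [inv_div], by rw [inv_div]⟩

theorem div {r s : RatFunc ℂ} {z v v' : ℂ} (h : HasVal r z v) (h' : HasVal s z v') (hv : v' ≠ 0) :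
    HasVal (r / s) z (v / v') := by
  simpa [div_eq_mul_inv] using h.mul (h'.inv hv)

theorem continuousAt {r : RatFunc ℂ} {z v : ℂ} (h : HasVal r z v) : ContinuousAt (val r) z := by
  have : val r = fun z => r.num.eval z / r.denom.eval z := rfl
  rw [this]
  exact (Polynomial.continuousAt _).div (Polynomial.continuousAt _) h.denom_ne

end HasVal

/-! ### Substitutions as ring homomorphisms, and values on the Riemann sphere -/

/-- Substituting a transcendental element kills no denominator; hence `RatFunc.eval` at `y` is
additive and multiplicative without exceptions. -/
theorem eval₂_ne_zero_of_transcendental (φ : ℂ →+* ℂ) {y : RatFunc ℂ}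
    (hy : Transcendental ℂ y) {p : Polynomial ℂ} (hp : p ≠ 0) :
    Polynomial.eval₂ (RatFunc.C.comp φ) y p ≠ 0 := by
  intro h
  rw [← Polynomial.eval₂_map] at h
  have h2 : Polynomial.aeval y (p.map φ) = 0 := h
  have := (transcendental_iff.1 hy) _ h2
  exact hp ((Polynomial.map_eq_zero φ).1 this)

/-- Evaluation of rational functions at a transcendental element as a ring homomorphism. -/
noncomputable def evalHom (φ : ℂ →+* ℂ) (y : RatFunc ℂ) (hy : Transcendental ℂ y) :
    RatFunc ℂ →+* RatFunc ℂ where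
  toFun r := r.eval (RatFunc.C.comp φ) y
  map_one' := RatFunc.eval_one _ _
  map_zero' := RatFunc.eval_zero _ _
  map_add' r s := RatFunc.eval_add _ _
    (eval₂_ne_zero_of_transcendental φ hy r.denom_ne_zero)
    (eval₂_ne_zero_of_transcendental φ hy s.denom_ne_zero)
  map_mul' r s := RatFunc.eval_mul _ _
    (eval₂_ne_zero_of_transcendental φ hy r.denom_ne_zero)
    (eval₂_ne_zero_of_transcendental φ hy s.denom_ne_zero)

theorem transcendental_X_inv : Transcendental ℂ (RatFunc.X⁻¹ : RatFunc ℂ) := fun h =>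
  RatFunc.transcendental_X (IsAlgebraic.inv_iff.1 h)

/-- The substitution `X ↦ 1 / X`. -/
noncomputable def invHom : RatFunc ℂ →+* RatFunc ℂ :=
  evalHom (RingHom.id ℂ) RatFunc.X⁻¹ transcendental_X_inv

theorem invHom_C (c : ℂ) : invHom (RatFunc.C c) = RatFunc.C c := RatFunc.eval_C _ _

theorem invHom_X : invHom RatFunc.X = RatFunc.X⁻¹ := RatFunc.eval_X _ _

/-- The substar operation as a ring homomorphism. -/
noncomputable def substarHom : Region → RatFunc ℂ →+* RatFunc ℂ
  | .disk => evalHom (starRingEnd ℂ) RatFunc.X⁻¹ transcendental_X_inv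
  | .halfPlane => evalHom (starRingEnd ℂ) RatFunc.X RatFunc.transcendental_X

theorem substar_eq (d : Region) (r : RatFunc ℂ) : substar d r = substarHom d r := by
  cases d <;> rfl

theorem substarHom_C (d : Region) (c : ℂ) :
    substarHom d (RatFunc.C c) = RatFunc.C (starRingEnd ℂ c) := by
  cases d <;> exact RatFunc.eval_C _ _

theorem substarHom_X_disk : substarHom .disk RatFunc.X = RatFunc.X⁻¹ := RatFunc.eval_X _ _

theorem substarHom_X_halfPlane : substarHom .halfPlane RatFunc.X = RatFunc.X := RatFunc.eval_X _ _

/-- The analogue of `HasVal` at points of the Riemann sphere. -/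
def HasSVal (r : RatFunc ℂ) : OnePoint ℂ → ℂ → Prop
  | none, v => HasVal (invHom r) 0 v
  | some z, v => HasVal r z v

namespace HasSVal

variable {r s : RatFunc ℂ} {t : OnePoint ℂ} {v v' : ℂ}

theorem val_eq (h : HasSVal r t v) : sphereVal r t = v := by
  match t, h with
  | none, h =>
    have h2 : HasVal (r.eval (RatFunc.C.comp (RingHom.id ℂ)) RatFunc.X⁻¹) 0 v := h
    rw [RingHom.comp_id] at h2
    exact HasVal.val_eq h2
  | some z, h => exact HasVal.val_eq h

theorem C (c : ℂ) (t : OnePoint ℂ) : HasSVal (RatFunc.C c) t c := by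
  match t with
  | none => simpa [HasSVal, invHom_C] using HasVal.C c 0
  | some z => exact HasVal.C c z

theorem one (t : OnePoint ℂ) : HasSVal 1 t 1 := by simpa using C 1 t

theorem zero (t : OnePoint ℂ) : HasSVal 0 t 0 := by simpa using C 0 t

theorem add (h : HasSVal r t v) (h' : HasSVal s t v') : HasSVal (r + s) t (v + v') := by
  match t, h, h' with
  | none, h, h' => simpa [HasSVal] using HasVal.add h h'
  | some z, h, h' => exact HasVal.add h h'

theorem mul (h : HasSVal r t v) (h' : HasSVal s t v') : HasSVal (r * s) t (v * v') := by
  match t, h, h' with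
  | none, h, h' => simpa [HasSVal] using HasVal.mul h h'
  | some z, h, h' => exact HasVal.mul h h'

theorem neg (h : HasSVal r t v) : HasSVal (-r) t (-v) := by
  simpa using (C (-1) t).mul h

theorem sub (h : HasSVal r t v) (h' : HasSVal s t v') : HasSVal (r - s) t (v - v') := by
  simpa [sub_eq_add_neg] using h.add h'.neg

theorem inv (h : HasSVal r t v) (hv : v ≠ 0) : HasSVal r⁻¹ t v⁻¹ := by
  match t, h with
  | none, h => simpa [HasSVal] using HasVal.inv h hv
  | some z, h => exact HasVal.inv h hv

theorem div (h : HasSVal r t v) (h' : HasSVal s t v') (hv : v' ≠ 0) :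
    HasSVal (r / s) t (v / v') := by
  simpa [div_eq_mul_inv] using h.mul (h'.inv hv)

end HasSVal

theorem measurable_sphereVal (r : RatFunc ℂ) : Measurable (sphereVal r) := by
  have he : MeasurableEmbedding ((↑) : ℂ → OnePoint ℂ) :=
    OnePoint.isOpenEmbedding_coe.measurableEmbedding
  have h1 : Measurable (val r) := by
    have : val r = fun z => r.num.eval z / r.denom.eval z := rfl
    rw [this]
    exact (Polynomial.continuous _).measurable.div (Polynomial.continuous _).measurable
  intro s hs
  -- The finite part is a quotient of polynomials on the open subset ℂ; the point at infinity
  -- contributes at most a singleton.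
  have hsplit : sphereVal r ⁻¹' s = ((↑) : ℂ → OnePoint ℂ) '' (val r ⁻¹' s) ∪
      ({OnePoint.infty} ∩ sphereVal r ⁻¹' s) := by
    ext t
    match t with
    | none =>
      constructor
      · intro h; exact Or.inr ⟨rfl, h⟩
      · rintro (⟨z, _, hz⟩ | ⟨_, h⟩)
        · exact absurd hz (OnePoint.coe_ne_infty z)
        · exact h
    | some z =>
      constructor
      · intro h; exact Or.inl ⟨z, h, rfl⟩
      · rintro (⟨z', hz', h⟩ | ⟨h, _⟩)
        · have : z' = z := OnePoint.coe_injective h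
          subst this; exact hz'
        · exact absurd h (OnePoint.coe_ne_infty z)
  rw [hsplit]
  refine (he.measurableSet_image.2 (h1 hs)).union ?_
  exact (Set.Subsingleton.anti Set.subsingleton_singleton Set.inter_subset_left).measurableSet

/-! ### The coordinate ζ_0 and the Möbius factors expressed through it -/

/-- The function `ζ_0` as a rational function. -/
noncomputable def W (d : Region) : RatFunc ℂ := zeta d (basePoint d)

/-- The values of `ζ_0`. -/
noncomputable def omega (d : Region) (z : ℂ) : ℂ := val (W d) z

/-- The unimodular constant of `ζ_a` as a Möbius transformation of `ζ_0`. -/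
noncomputable def rot (d : Region) (a : ℂ) : ℂ :=
  match d with
  | .disk => unimod .disk a
  | .halfPlane => -unimod .halfPlane a * ((a + Complex.I) / (conj a - Complex.I))

/-- The constant `c` in `ϖ_0 / ϖ_a = c / (1 - conj (ζ_0(a)) ζ_0)`. -/
noncomputable def ratioConst (d : Region) (a : ℂ) : ℂ :=
  match d with
  | .disk => 1
  | .halfPlane => -2 * Complex.I / (conj a - Complex.I)

theorem domain_isOpen (d : Region) : IsOpen (domain d) := by
  cases d
  · exact isOpen_lt continuous_norm continuous_const
  · exact isOpen_lt continuous_const Complex.continuous_im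

theorem basePoint_mem (d : Region) : basePoint d ∈ domain d := by
  cases d <;> simp [basePoint, domain]

/-- The region is open and so has no isolated points: exceptional points can be filled in by
continuity. This replaces every removable-singularity argument about the cofactors and Cauchy
transforms below. -/
theorem eqOn_domain {d : Region} {f g : ℂ → ℂ} (hf : ContinuousOn f (domain d))
    (hg : ContinuousOn g (domain d)) {s : Set ℂ} (hs : s.Finite)
    (h : ∀ z ∈ domain d, z ∉ s → f z = g z) : ∀ z ∈ domain d, f z = g z := by
  intro z hz
  have hnhds := (domain_isOpen d).mem_nhds hz
  have hfz := ((hf.continuousAt hnhds).tendsto).mono_left (nhdsWithin_le_nhds (s := {z}ᶜ))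
  have hgz := ((hg.continuousAt hnhds).tendsto).mono_left (nhdsWithin_le_nhds (s := {z}ᶜ))
  have hev : ∀ᶠ y in 𝓝[≠] z, y ∉ s := by
    have h1 : (s \ {z})ᶜ ∈ 𝓝 z := (hs.subset sdiff_subset).isClosed.isOpen_compl.mem_nhds (by simp)
    filter_upwards [nhdsWithin_le_nhds h1, self_mem_nhdsWithin] with y hy hy' hys
    exact hy ⟨hys, hy'⟩
  refine tendsto_nhds_unique_of_eventuallyEq hfz hgz ?_
  filter_upwards [hev, nhdsWithin_le_nhds hnhds] with y hy hy'
  exact h y hy' hy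

theorem domain_infinite (d : Region) : (domain d).Infinite := by
  intro h
  have h1 := eqOn_domain (d := d) (f := fun _ => (0 : ℂ)) (g := fun _ => (1 : ℂ))
    continuousOn_const continuousOn_const h (fun z hz hz' => absurd hz hz') _ (basePoint_mem d)
  norm_num at h1

theorem ratFunc_ext {d : Region} {r s : RatFunc ℂ} (h : ∀ z ∈ domain d, val r z = val s z) :
    r = s := by
  -- The extra factor vanishes at the poles, where `val` carries no information.
  have hp : (r.num * s.denom - s.num * r.denom) * (r.denom * s.denom) = 0 := by
    refine Polynomial.eq_zero_of_infinite_isRoot _ ((domain_infinite d).mono fun z hz => ?_)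
    have h1 : r.num.eval z / r.denom.eval z = s.num.eval z / s.denom.eval z := h z hz
    change Polynomial.eval z _ = 0
    simp only [Polynomial.eval_mul, Polynomial.eval_sub]
    by_cases hr : r.denom.eval z = 0
    · simp [hr]
    by_cases hs : s.denom.eval z = 0
    · simp [hs]
    rw [div_eq_div_iff hr hs] at h1
    rw [h1, sub_self, zero_mul]
  have hp' := (mul_eq_zero.1 hp).resolve_right (mul_ne_zero r.denom_ne_zero s.denom_ne_zero)
  rw [← RatFunc.num_div_denom r, ← RatFunc.num_div_denom s,
    div_eq_div_iff (RatFunc.algebraMap_ne_zero r.denom_ne_zero)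
      (RatFunc.algebraMap_ne_zero s.denom_ne_zero), ← map_mul, ← map_mul, sub_eq_zero.1 hp']

theorem varpiStar_ne_zero (a : ℂ) : varpiStar a ≠ 0 := by
  intro h
  have h1 : HasVal (varpiStar a) (a + 1) (a + 1 - a) := (HasVal.X _).sub (HasVal.C _ _)
  rw [h] at h1
  have := h1.unique (HasVal.zero _)
  simp at this

theorem hasVal_varpiStar (a z : ℂ) : HasVal (varpiStar a) z (z - a) :=
  (HasVal.X _).sub (HasVal.C _ _)

theorem hasVal_varpi_disk (a z : ℂ) : HasVal (varpi .disk a) z (1 - conj a * z) :=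
  (HasVal.one _).sub ((HasVal.C _ _).mul (HasVal.X _))

theorem hasVal_varpi_halfPlane (a z : ℂ) : HasVal (varpi .halfPlane a) z (z - conj a) :=
  (HasVal.X _).sub (HasVal.C _ _)

theorem hasVal_varpi (d : Region) (a z : ℂ) : HasVal (varpi d a) z (val (varpi d a) z) := by
  cases d
  · have := hasVal_varpi_disk a z
    rwa [this.val_eq]
  · have := hasVal_varpi_halfPlane a z
    rwa [this.val_eq]

theorem one_sub_conj_mul_ne {x y : ℂ} (hx : ‖x‖ < 1) (hy : ‖y‖ ≤ 1) : 1 - conj x * y ≠ 0 := by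
  intro h
  have h1 : ‖conj x * y‖ = 1 := by
    rw [← sub_eq_zero.1 h]; simp
  rw [norm_mul, RCLike.norm_conj] at h1
  nlinarith [norm_nonneg x, norm_nonneg y]

theorem val_varpi_ne_zero {d : Region} {a z : ℂ} (ha : a ∈ domain d) (hz : z ∈ domain d) :
    val (varpi d a) z ≠ 0 := by
  cases d
  · rw [(hasVal_varpi_disk a z).val_eq]
    exact one_sub_conj_mul_ne ha (le_of_lt hz)
  · rw [(hasVal_varpi_halfPlane a z).val_eq]
    intro h
    have h1 := congrArg Complex.im h
    simp only [Complex.sub_im, Complex.conj_im, Complex.zero_im] at h1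
    simp only [domain, mem_ofPred_eq] at ha hz
    linarith

theorem varpi_ne_zero {d : Region} {a : ℂ} (ha : a ∈ domain d) : varpi d a ≠ 0 := by
  intro h
  have h1 := hasVal_varpi d a a
  rw [h] at h1
  exact val_varpi_ne_zero ha ha (by rw [h]; exact (HasVal.zero a).val_eq)

theorem unimod_basePoint (d : Region) : unimod d (basePoint d) = 1 := by
  simp [unimod]

theorem one_add_sq_ne {a : ℂ} (ha : 0 < a.im) (h : a ≠ Complex.I) : 1 + a ^ 2 ≠ 0 := by
  intro h0
  have : (a - Complex.I) * (a + Complex.I) = 0 := by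
    linear_combination h0 - Complex.I_sq
  rcases mul_eq_zero.1 this with h1 | h1
  · exact h (sub_eq_zero.1 h1)
  · have := congrArg Complex.im h1
    simp at this
    linarith

theorem norm_unimod {d : Region} {a : ℂ} (ha : a ∈ domain d) : ‖unimod d a‖ = 1 := by
  unfold unimod
  split_ifs with h
  · simp
  · cases d
    · have h0 : a ≠ 0 := h
      have : ‖a‖ ≠ 0 := by simpa using h0
      simp [this]
    · have h0 := one_add_sq_ne ha h
      have : ‖1 + a ^ 2‖ ≠ 0 := by simpa using h0
      simp only [norm_div, Complex.norm_real, norm_norm]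
      exact div_self this

theorem unimod_ne_zero {d : Region} {a : ℂ} (ha : a ∈ domain d) : unimod d a ≠ 0 := by
  intro h
  have := norm_unimod ha
  rw [h] at this; simp at this

theorem W_eq (d : Region) : W d = varpiStar (basePoint d) / varpi d (basePoint d) := by
  simp [W, zeta, unimod_basePoint]

theorem W_disk : W .disk = RatFunc.X := by
  rw [W_eq]; simp [varpiStar, varpi, basePoint]

theorem W_halfPlane : W .halfPlane =
    (RatFunc.X - RatFunc.C Complex.I) / (RatFunc.X + RatFunc.C Complex.I) := by
  rw [W_eq]; simp [varpiStar, varpi, basePoint]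

theorem varpiStar_basePoint (d : Region) :
    varpiStar (basePoint d) = W d * varpi d (basePoint d) := by
  rw [W_eq, div_mul_cancel₀ _ (varpi_ne_zero (basePoint_mem d))]

theorem hasVal_W {d : Region} {z : ℂ} (hz : z ∈ domain d) : HasVal (W d) z (omega d z) := by
  have h : HasVal (W d) z _ := W_eq d ▸ (hasVal_varpiStar (basePoint d) z).div
    (hasVal_varpi d (basePoint d) z) (val_varpi_ne_zero (basePoint_mem d) hz)
  unfold omega
  rwa [h.val_eq]

theorem omega_disk (z : ℂ) : omega .disk z = z := by
  unfold omega; rw [W_disk]; exact (HasVal.X z).val_eq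

theorem omega_halfPlane {z : ℂ} (hz : z + Complex.I ≠ 0) :
    omega .halfPlane z = (z - Complex.I) / (z + Complex.I) := by
  unfold omega; rw [W_halfPlane]
  exact (((HasVal.X z).sub (HasVal.C _ _)).div ((HasVal.X z).add (HasVal.C _ _)) hz).val_eq

theorem add_I_ne {z : ℂ} (hz : z ∈ domain .halfPlane) : z + Complex.I ≠ 0 := by
  intro h
  have := congrArg Complex.im h
  simp only [Complex.add_im, Complex.I_im, Complex.zero_im] at this
  simp only [domain, mem_ofPred_eq] at hz
  linarith

theorem conj_sub_I_ne {z : ℂ} (hz : z ∈ domain .halfPlane) : conj z - Complex.I ≠ 0 := by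
  intro h
  apply add_I_ne hz
  simpa using congrArg conj h

theorem omega_basePoint (d : Region) : omega d (basePoint d) = 0 := by
  cases d
  · simp [omega_disk, basePoint]
  · rw [omega_halfPlane (add_I_ne (basePoint_mem _))]; simp [basePoint]

theorem norm_omega_lt {d : Region} {z : ℂ} (hz : z ∈ domain d) : ‖omega d z‖ < 1 := by
  cases d
  · rw [omega_disk]; exact hz
  · have h := add_I_ne hz
    rw [omega_halfPlane h, norm_div, div_lt_one (norm_pos_iff.2 h)]
    refine lt_of_pow_lt_pow_left₀ 2 (norm_nonneg _) ?_
    rw [← Complex.normSq_eq_norm_sq, ← Complex.normSq_eq_norm_sq, Complex.normSq_apply,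
      Complex.normSq_apply]
    simp only [domain, mem_ofPred_eq] at hz
    simp
    nlinarith

theorem omega_injOn (d : Region) : InjOn (omega d) (domain d) := by
  intro z hz z' hz' h
  cases d
  · simpa [omega_disk] using h
  · rw [omega_halfPlane (add_I_ne hz), omega_halfPlane (add_I_ne hz'),
      div_eq_div_iff (add_I_ne hz) (add_I_ne hz')] at h
    have : 2 * Complex.I * (z - z') = 0 := by linear_combination h
    simpa [sub_eq_zero] using this

theorem continuousOn_omega (d : Region) : ContinuousOn (omega d) (domain d) := fun _ hz =>
  (hasVal_W hz).continuousAt.continuousWithinAt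

theorem sphereVal_W {d : Region} {t : OnePoint ℂ} (ht : t ∈ boundary d) :
    HasSVal (W d) t (sphereVal (W d) t) ∧ ‖sphereVal (W d) t‖ = 1 := by
  suffices ∃ v, HasSVal (W d) t v ∧ ‖v‖ = 1 by
    obtain ⟨v, hv, hn⟩ := this
    rw [hv.val_eq]
    exact ⟨hv, hn⟩
  cases d
  · obtain ⟨z, hz, rfl⟩ := ht
    refine ⟨z, ?_, hz⟩
    rw [W_disk]
    exact HasVal.X z
  · rcases ht with rfl | ⟨z, hz, rfl⟩
    · refine ⟨1, ?_, by simp⟩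
      have h1 : invHom (W .halfPlane) =
          (1 - RatFunc.C Complex.I * RatFunc.X) / (1 + RatFunc.C Complex.I * RatFunc.X) := by
        rw [W_halfPlane, map_div₀, map_sub, map_add, invHom_C, invHom_X]
        have hX : (RatFunc.X : RatFunc ℂ) ≠ 0 := RatFunc.X_ne_zero
        rw [← mul_div_mul_right _ _ hX, sub_mul, add_mul, inv_mul_cancel₀ hX]
      have h2 : HasVal (invHom (W .halfPlane)) 0
          ((1 - Complex.I * 0) / (1 + Complex.I * 0)) := by
        rw [h1]
        exact ((HasVal.one _).sub ((HasVal.C _ _).mul (HasVal.X _))).div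
          ((HasVal.one _).add ((HasVal.C _ _).mul (HasVal.X _))) (by simp)
      have h3 : (1 - Complex.I * 0) / (1 + Complex.I * 0) = 1 := by simp
      rw [h3] at h2
      exact h2
    · have hz0 : z.im = 0 := hz
      have hne : z + Complex.I ≠ 0 := by
        intro h
        have := congrArg Complex.im h
        simp [hz0] at this
      refine ⟨(z - Complex.I) / (z + Complex.I), ?_, ?_⟩
      · rw [W_halfPlane]
        exact ((HasVal.X z).sub (HasVal.C _ _)).div ((HasVal.X z).add (HasVal.C _ _)) hne
      · have h1 : z - Complex.I = conj (z + Complex.I) := by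
          apply Complex.ext <;> simp [hz0]
        rw [norm_div, h1, RCLike.norm_conj, div_self (norm_ne_zero_iff.2 hne)]

theorem W_sub_C_ne (d : Region) (c : ℂ) : W d - RatFunc.C c ≠ 0 := by
  intro h
  have h1 : ∀ z ∈ domain d, omega d z = c := fun z hz => by
    have h2 := (hasVal_W hz).sub (HasVal.C c z)
    rw [h] at h2
    exact sub_eq_zero.1 (h2.unique (HasVal.zero z))
  refine domain_infinite d ((Set.finite_singleton (basePoint d)).subset fun z hz => ?_)
  exact omega_injOn d hz (basePoint_mem d) ((h1 z hz).trans (h1 _ (basePoint_mem d)).symm)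

theorem W_ne_zero (d : Region) : W d ≠ 0 := by simpa using W_sub_C_ne d 0

theorem one_sub_C_mul_W_ne (d : Region) (c : ℂ) : 1 - RatFunc.C c * W d ≠ 0 := by
  intro h
  have h1 := (HasVal.one _).sub ((HasVal.C c _).mul (hasVal_W (basePoint_mem d)))
  rw [h, omega_basePoint] at h1
  simpa using h1.unique (HasVal.zero _)

theorem substarHom_W (d : Region) : substarHom d (W d) = (W d)⁻¹ := by
  cases d
  · rw [W_disk, substarHom_X_disk]
  · rw [W_halfPlane, map_div₀, map_sub, map_add, substarHom_C, substarHom_X_halfPlane, inv_div]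
    simp [sub_eq_add_neg]

theorem X_add_I_ne : (RatFunc.X + RatFunc.C Complex.I : RatFunc ℂ) ≠ 0 := by
  simpa [varpi, basePoint] using varpi_ne_zero (basePoint_mem .halfPlane)

theorem W_sub_C_omega {d : Region} {a : ℂ} (ha : a ∈ domain d) :
    ∃ c : ℂ, W d - RatFunc.C (omega d a) =
      RatFunc.C c * (varpiStar a / varpi d (basePoint d)) ∧
      c = (match d with
        | .disk => 1
        | .halfPlane => 2 * Complex.I / (a + Complex.I)) := by
  refine ⟨_, ?_, rfl⟩
  cases d
  · simp [W_disk, omega_disk, varpiStar, varpi, basePoint]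
  · have h1 := X_add_I_ne
    have h2 := add_I_ne ha
    have h3 : (RatFunc.C a + RatFunc.C Complex.I : RatFunc ℂ) ≠ 0 := by
      rw [← map_add]; exact (map_ne_zero _).2 h2
    rw [W_halfPlane, omega_halfPlane h2]
    simp only [varpi, varpiStar, basePoint, map_div₀, map_sub, map_add, map_mul, Complex.conj_I,
      map_neg, sub_neg_eq_add, map_ofNat]
    field_simp
    ring

theorem one_sub_omega_mul_W {d : Region} {a : ℂ} (ha : a ∈ domain d) :
    varpi d (basePoint d) / varpi d a =
      RatFunc.C (ratioConst d a) * (1 - RatFunc.C (conj (omega d a)) * W d)⁻¹ := by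
  rw [← div_eq_mul_inv, div_eq_div_iff (varpi_ne_zero ha) (one_sub_C_mul_W_ne d _)]
  cases d
  · simp [W_disk, omega_disk, varpi, basePoint, ratioConst]
  · have h1 := X_add_I_ne
    have h2 := conj_sub_I_ne ha
    have h3 : (RatFunc.C (conj a) - RatFunc.C Complex.I : RatFunc ℂ) ≠ 0 := by
      rw [← map_sub]; exact (map_ne_zero _).2 h2
    rw [W_halfPlane, omega_halfPlane (add_I_ne ha)]
    simp only [varpi, basePoint, ratioConst, map_div₀, map_sub, map_add, map_mul, Complex.conj_I,
      map_neg, sub_neg_eq_add, map_ofNat, ← sub_eq_add_neg]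
    field_simp
    ring

/-- W - ζ_0(a) is a constant times ϖ*_a/ϖ_0, and 1 - conj(ζ_0(a)) W is a constant times ϖ_a/ϖ_0;
`rot` collects the constants. It is the bridge that makes the two regions indistinguishable later
on. -/
theorem zeta_eq {d : Region} {a : ℂ} (ha : a ∈ domain d) :
    zeta d a = RatFunc.C (rot d a) *
      ((W d - RatFunc.C (omega d a)) * (1 - RatFunc.C (conj (omega d a)) * W d)⁻¹) := by
  obtain ⟨c, hc, hc'⟩ := W_sub_C_omega ha
  have h2 := one_sub_omega_mul_W ha
  have hb := varpi_ne_zero (basePoint_mem d)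
  have hr : ratioConst d a ≠ 0 := by
    cases d
    · simp [ratioConst]
    · simpa [ratioConst] using conj_sub_I_ne ha
  have hk : unimod d a = rot d a * c / ratioConst d a := by
    cases d
    · simp [hc', rot, ratioConst]
    · have h3 := add_I_ne ha
      have h4 := conj_sub_I_ne ha
      simp only [hc', rot, ratioConst]
      field_simp
  have hR : (RatFunc.C (ratioConst d a) : RatFunc ℂ) ≠ 0 := by simpa using hr
  have h5 : (1 - RatFunc.C (conj (omega d a)) * W d)⁻¹ =
      (RatFunc.C (ratioConst d a))⁻¹ * (varpi d (basePoint d) / varpi d a) := by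
    rw [h2, ← mul_assoc, inv_mul_cancel₀ hR, one_mul]
  rw [h5, hc, zeta, hk, map_div₀, map_mul]
  field_simp

theorem ratioConst_ne_zero {d : Region} {a : ℂ} (ha : a ∈ domain d) : ratioConst d a ≠ 0 := by
  cases d
  · simp [ratioConst]
  · simpa [ratioConst] using conj_sub_I_ne ha

theorem norm_rot {d : Region} {a : ℂ} (ha : a ∈ domain d) : ‖rot d a‖ = 1 := by
  cases d
  · exact norm_unimod ha
  · have h1 : a + Complex.I = conj (conj a - Complex.I) := by simp
    simp only [rot]
    rw [norm_mul, norm_neg, norm_unimod ha, norm_div, h1, RCLike.norm_conj,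
      div_self (norm_ne_zero_iff.2 (conj_sub_I_ne ha)), one_mul]

/-- The positive number `ϖ_0(α_0) / ϖ_a(a)`. -/
noncomputable def weightRatio (d : Region) (a : ℂ) : ℝ :=
  (val (varpi d (basePoint d)) (basePoint d) / val (varpi d a) a).re

/-- This relation among the constants is what makes the candidate have norm exactly 1; it accounts
for the factor ϖ_0(α_0)/ϖ_n(α_n) in κ_n². -/
theorem weightRatio_eq {d : Region} {a : ℂ} (ha : a ∈ domain d) :
    0 < weightRatio d a ∧
      unimod d a * ratioConst d a ^ 2 =
        rot d a * weightRatio d a * (1 - conj (omega d a) * omega d a) := by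
  cases d
  · have h1 : val (varpi .disk (basePoint .disk)) (basePoint .disk) = 1 := by
      rw [(hasVal_varpi_disk _ _).val_eq]; simp [basePoint]
    have h2 : val (varpi .disk a) a = ((1 - ‖a‖ ^ 2 : ℝ) : ℂ) := by
      rw [(hasVal_varpi_disk _ _).val_eq, Complex.conj_mul']; push_cast; ring
    have hlt : ‖a‖ < 1 := ha
    have hpos : 0 < 1 - ‖a‖ ^ 2 := by nlinarith [norm_nonneg a]
    have h3 : weightRatio .disk a = (1 - ‖a‖ ^ 2)⁻¹ := by
      rw [weightRatio, h1, h2, one_div, ← Complex.ofReal_inv, Complex.ofReal_re]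
    refine ⟨by rw [h3]; positivity, ?_⟩
    rw [h3, omega_disk, Complex.conj_mul']
    simp only [ratioConst, rot]
    have : ((1 - ‖a‖ ^ 2 : ℝ) : ℂ) ≠ 0 := by exact_mod_cast hpos.ne'
    push_cast at this ⊢
    field_simp
  · have him : 0 < a.im := ha
    have h1 : val (varpi .halfPlane (basePoint .halfPlane)) (basePoint .halfPlane)
        = 2 * Complex.I := by
      rw [(hasVal_varpi_halfPlane _ _).val_eq]; simp [basePoint]; ring
    have h2 : val (varpi .halfPlane a) a = 2 * Complex.I * (a.im : ℂ) := by
      rw [(hasVal_varpi_halfPlane _ _).val_eq]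
      apply Complex.ext <;> simp; ring
    have h3 : weightRatio .halfPlane a = (a.im)⁻¹ := by
      rw [weightRatio, h1, h2, div_mul_eq_div_div, div_self (by simp), one_div,
        ← Complex.ofReal_inv, Complex.ofReal_re]
    refine ⟨by rw [h3]; positivity, ?_⟩
    have h4 := add_I_ne ha
    have h5 := conj_sub_I_ne ha
    have h6 : (a.im : ℂ) ≠ 0 := by exact_mod_cast him.ne'
    have h7 : conj a = a - 2 * Complex.I * (a.im : ℂ) := by
      apply Complex.ext <;> simp; ring
    rw [h3, omega_halfPlane h4]
    simp only [ratioConst, rot, map_div₀, map_sub, map_add, Complex.conj_I, sub_neg_eq_add,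
      ← sub_eq_add_neg]
    push_cast
    rw [h7] at h5 ⊢
    field_simp
    ring_nf

theorem substarHom_ratio {d : Region} {a : ℂ} (ha : a ∈ domain d) :
    substarHom d (varpi d (basePoint d) / varpi d a) =
      varpiStar (basePoint d) / varpiStar a := by
  have h := varpiStar_ne_zero a
  cases d
  · have hX : (RatFunc.X : RatFunc ℂ) ≠ 0 := RatFunc.X_ne_zero
    have h1 : (RatFunc.X - RatFunc.C a : RatFunc ℂ) ≠ 0 := h
    simp only [varpi, varpiStar, basePoint, map_div₀, map_sub, map_mul, map_one, substarHom_C,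
      substarHom_X_disk, Complex.conj_conj, map_zero, zero_mul, sub_zero]
    rw [← mul_div_mul_right _ _ hX, sub_mul, mul_assoc, inv_mul_cancel₀ hX]
    simp
  · simp [varpi, varpiStar, basePoint, substarHom_C, substarHom_X_halfPlane, sub_eq_add_neg]

theorem substarHom_substarHom (d : Region) (r : RatFunc ℂ) :
    substarHom d (substarHom d r) = r := by
  have h : ((substarHom d).comp (substarHom d)).comp
      (algebraMap (Polynomial ℂ) (RatFunc ℂ)) = algebraMap _ _ := by
    apply Polynomial.ringHom_ext
    · intro c
      simp [substarHom_C]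
    · cases d <;> simp [substarHom_X_disk, substarHom_X_halfPlane]
  have h2 : ∀ p : Polynomial ℂ, substarHom d (substarHom d (algebraMap _ _ p)) =
      algebraMap _ _ p := fun p => DFunLike.congr_fun h p
  rw [← RatFunc.num_div_denom r, map_div₀, map_div₀, h2, h2]

theorem hasVal_zeta {d : Region} {a z : ℂ} (ha : a ∈ domain d) (hz : z ∈ domain d) :
    HasVal (zeta d a) z (val (zeta d a) z) := by
  have h : HasVal (zeta d a) z _ := (HasVal.C (unimod d a) z).mul
    ((hasVal_varpiStar a z).div (hasVal_varpi d a z) (val_varpi_ne_zero ha hz))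
  rwa [h.val_eq]

theorem val_zeta {d : Region} {a z : ℂ} (ha : a ∈ domain d) (hz : z ∈ domain d) :
    val (zeta d a) z = unimod d a * ((z - a) / val (varpi d a) z) :=
  HasVal.val_eq ((HasVal.C (unimod d a) z).mul
    ((hasVal_varpiStar a z).div (hasVal_varpi d a z) (val_varpi_ne_zero ha hz)))

theorem val_zeta_self {d : Region} {a : ℂ} (ha : a ∈ domain d) : val (zeta d a) a = 0 := by
  simp [val_zeta ha ha]

theorem val_zeta_ne_zero {d : Region} {a z : ℂ} (ha : a ∈ domain d) (hz : z ∈ domain d)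
    (h : z ≠ a) : val (zeta d a) z ≠ 0 := by
  rw [val_zeta ha hz]
  exact mul_ne_zero (unimod_ne_zero ha) (div_ne_zero (sub_ne_zero.2 h) (val_varpi_ne_zero ha hz))

theorem one_sub_conj_omega_ne {d : Region} {a z : ℂ} (ha : a ∈ domain d) (hz : z ∈ domain d) :
    1 - conj (omega d a) * omega d z ≠ 0 :=
  one_sub_conj_mul_ne (norm_omega_lt ha) (norm_omega_lt hz).le

theorem hasVal_one_sub {d : Region} {z : ℂ} (c : ℂ) (hz : z ∈ domain d) :
    HasVal (1 - RatFunc.C c * W d) z (1 - c * omega d z) :=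
  (HasVal.one z).sub ((HasVal.C _ _).mul (hasVal_W hz))

theorem val_zeta_omega {d : Region} {a z : ℂ} (ha : a ∈ domain d) (hz : z ∈ domain d) :
    val (zeta d a) z = rot d a *
      ((omega d z - omega d a) * (1 - conj (omega d a) * omega d z)⁻¹) := by
  rw [zeta_eq ha]
  exact HasVal.val_eq ((HasVal.C _ _).mul (((hasVal_W hz).sub (HasVal.C _ _)).mul
    ((hasVal_one_sub _ hz).inv (one_sub_conj_omega_ne ha hz))))

theorem C_conj_mul_C {c : ℂ} (h : ‖c‖ = 1) :
    (RatFunc.C (conj c) : RatFunc ℂ) = (RatFunc.C c)⁻¹ := by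
  have h1 : c * conj c = 1 := by rw [Complex.mul_conj']; simp [h]
  exact eq_inv_of_mul_eq_one_right (by rw [← map_mul, h1, map_one])

theorem C_rot_ne_zero {d : Region} {a : ℂ} (ha : a ∈ domain d) :
    (RatFunc.C (rot d a) : RatFunc ℂ) ≠ 0 := by
  refine (map_ne_zero _).2 fun h => ?_
  have := norm_rot ha
  rw [h] at this; simp at this

theorem zeta_ne_zero {d : Region} {a : ℂ} (ha : a ∈ domain d) : zeta d a ≠ 0 := by
  rw [zeta_eq ha]
  exact mul_ne_zero (C_rot_ne_zero ha)
    (mul_ne_zero (W_sub_C_ne d _) (inv_ne_zero (one_sub_C_mul_W_ne d _)))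

theorem substarHom_zeta {d : Region} {a : ℂ} (ha : a ∈ domain d) :
    substarHom d (zeta d a) = (zeta d a)⁻¹ := by
  have h1 := W_ne_zero d
  have h2 := W_sub_C_ne d (omega d a)
  have h3 := one_sub_C_mul_W_ne d (conj (omega d a))
  have h4 := C_rot_ne_zero ha
  rw [zeta_eq ha]
  simp only [map_mul, map_sub, map_one, map_inv₀, substarHom_C, substarHom_W, Complex.conj_conj,
    C_conj_mul_C (norm_rot ha)]
  have h5 : (1 - RatFunc.C (omega d a) * (W d)⁻¹) = (W d - RatFunc.C (omega d a)) * (W d)⁻¹ := by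
    field_simp
  have h6 : ((W d)⁻¹ - RatFunc.C (conj (omega d a))) =
      (1 - RatFunc.C (conj (omega d a)) * W d) * (W d)⁻¹ := by
    field_simp
  rw [h5, h6]
  field_simp

/-! ### Blaschke products and the Wall recurrences -/

section Blaschke

variable {d : Region} {α : ℕ → ℂ}

theorem blaschke_zero : blaschke d α 0 = 1 := by simp [blaschke]

theorem blaschke_succ (n : ℕ) :
    blaschke d α (n + 1) = blaschke d α n * zeta d (α (n + 1)) := by
  rw [blaschke, blaschke, Finset.prod_Icc_succ_top (by omega)]

variable (hα : ∀ n, α n ∈ domain d)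
include hα

theorem blaschke_ne_zero (n : ℕ) : blaschke d α n ≠ 0 :=
  Finset.prod_ne_zero_iff.2 fun _ _ => zeta_ne_zero (hα _)

theorem substarHom_blaschke (n : ℕ) :
    substarHom d (blaschke d α n) = (blaschke d α n)⁻¹ := by
  simp [blaschke, map_prod, substarHom_zeta (hα _)]

theorem hasVal_blaschke (n : ℕ) {z : ℂ} (hz : z ∈ domain d) :
    HasVal (blaschke d α n) z (val (blaschke d α n) z) ∧
    val (blaschke d α n) z = ∏ k ∈ Finset.Icc 1 n, val (zeta d (α k)) z := by
  suffices HasVal (blaschke d α n) z (∏ k ∈ Finset.Icc 1 n, val (zeta d (α k)) z) by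
    rw [this.val_eq]; exact ⟨this, rfl⟩
  induction n with
  | zero => simpa [blaschke_zero] using HasVal.one z
  | succ n ih =>
    rw [blaschke_succ, Finset.prod_Icc_succ_top (by omega)]
    exact ih.mul (hasVal_zeta (hα _) hz)

variable (f : ℂ → ℂ)

omit hα in
theorem wallR_succ (n : ℕ) : wallR d α f (n + 1) = wallR d α f n +
    RatFunc.C (npParam d α f (n + 1)) * zeta d (α (n + 1)) *
      supstar d α n (wallS d α f n) := rfl

omit hα in
theorem wallS_succ (n : ℕ) : wallS d α f (n + 1) = wallS d α f n +
    RatFunc.C (npParam d α f (n + 1)) * zeta d (α (n + 1)) *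
      supstar d α n (wallR d α f n) := rfl

/-- Raising the superstar index multiplies by ζ_{n+1}, whose substar is its inverse, and applying
the superstar twice at index n gives back `s`. Both superstarred Wall recurrences are instances. -/
theorem supstar_succ_add (n : ℕ) (g : ℂ) (r s : RatFunc ℂ) :
    supstar d α (n + 1) (r + RatFunc.C g * zeta d (α (n + 1)) * supstar d α n s) =
      zeta d (α (n + 1)) * supstar d α n r + RatFunc.C (conj g) * s := by
  have h := blaschke_ne_zero hα n
  have h2 := zeta_ne_zero (hα (n + 1))
  simp only [supstar, substar_eq, map_mul, map_add, substarHom_blaschke hα, substarHom_substarHom,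
    substarHom_C, substarHom_zeta (hα _), blaschke_succ]
  field_simp

theorem supstar_wallR_succ (n : ℕ) : supstar d α (n + 1) (wallR d α f (n + 1)) =
    zeta d (α (n + 1)) * supstar d α n (wallR d α f n) +
      RatFunc.C (conj (npParam d α f (n + 1))) * wallS d α f n :=
  supstar_succ_add hα _ _ _ _

theorem supstar_wallS_succ (n : ℕ) : supstar d α (n + 1) (wallS d α f (n + 1)) =
    zeta d (α (n + 1)) * supstar d α n (wallS d α f n) +
      RatFunc.C (conj (npParam d α f (n + 1))) * wallR d α f n :=
  supstar_succ_add hα _ _ _ _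

omit hα in
theorem wallR_zero : wallR d α f 0 = RatFunc.C (npParam d α f 0) := rfl

omit hα in
theorem wallS_zero : wallS d α f 0 = 1 := rfl

omit hα in
theorem supstar_wallR_zero : supstar d α 0 (wallR d α f 0) =
    RatFunc.C (conj (npParam d α f 0)) := by
  simp [supstar, substar_eq, wallR_zero, blaschke_zero, substarHom_C]

omit hα in
theorem supstar_wallS_zero : supstar d α 0 (wallS d α f 0) = 1 := by
  simp [supstar, substar_eq, wallS_zero, blaschke_zero]

/-- Each recurrence step multiplies the determinant by ζ_{n+1}(1 - |γ_{n+1}|²). -/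
theorem wall_det (n : ℕ) :
    wallS d α f n * supstar d α n (wallS d α f n) -
      wallR d α f n * supstar d α n (wallR d α f n) =
      RatFunc.C ((upsilon d α f n : ℝ) : ℂ) * blaschke d α n := by
  have hnorm : ∀ c : ℂ, ((1 - ‖c‖ ^ 2 : ℝ) : ℂ) = 1 - c * conj c := fun c => by
    rw [Complex.mul_conj']; push_cast; rfl
  induction n with
  | zero =>
    rw [supstar_wallR_zero, supstar_wallS_zero, wallR_zero, wallS_zero, blaschke_zero, upsilon]
    rw [Finset.prod_range_one, hnorm]
    simp
  | succ n ih =>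
    rw [supstar_wallR_succ hα, supstar_wallS_succ hα, wallR_succ, wallS_succ, blaschke_succ]
    have : upsilon d α f (n + 1) = upsilon d α f n * (1 - ‖npParam d α f (n + 1)‖ ^ 2) := by
      rw [upsilon, Finset.prod_range_succ]; rfl
    rw [this, Complex.ofReal_mul, hnorm]
    simp only [map_mul, map_sub, map_one]
    linear_combination (zeta d (α (n + 1)) * (1 - RatFunc.C (npParam d α f (n + 1)) *
      RatFunc.C (conj (npParam d α f (n + 1))))) * ih

/-- Every one of `R_n`, `S_n`, `R_n^*`, `S_n^*` has a property that is inherited along the Wall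
recurrences. -/
theorem wall_induction {P : ℕ → RatFunc ℂ → Prop} (hC : ∀ c, P 0 (RatFunc.C c))
    (hadd : ∀ n r s, P n r → P n s → P n (r + s))
    (hmul : ∀ n c r, P n r → P n (RatFunc.C c * r))
    (hmono : ∀ n r, P n r → P (n + 1) r)
    (hzeta : ∀ n r, P n r → P (n + 1) (zeta d (α (n + 1)) * r)) (n : ℕ) :
    P n (wallR d α f n) ∧ P n (wallS d α f n) ∧ P n (supstar d α n (wallR d α f n)) ∧
      P n (supstar d α n (wallS d α f n)) := by
  induction n with
  | zero =>
    rw [supstar_wallR_zero, supstar_wallS_zero, wallR_zero, wallS_zero]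
    have h1 : P 0 1 := by simpa using hC 1
    exact ⟨hC _, h1, hC _, h1⟩
  | succ n ih =>
    obtain ⟨h1, h2, h3, h4⟩ := ih
    rw [supstar_wallR_succ hα, supstar_wallS_succ hα, wallR_succ, wallS_succ, mul_assoc,
      mul_assoc]
    exact ⟨hadd _ _ _ (hmono _ _ h1) (hmul _ _ _ (hzeta _ _ h4)),
      hadd _ _ _ (hmono _ _ h2) (hmul _ _ _ (hzeta _ _ h3)),
      hadd _ _ _ (hzeta _ _ h3) (hmul _ _ _ (hmono _ _ h2)),
      hadd _ _ _ (hzeta _ _ h4) (hmul _ _ _ (hmono _ _ h1))⟩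

theorem hasVal_wall (n : ℕ) {z : ℂ} (hz : z ∈ domain d) :
    HasVal (wallR d α f n) z (val (wallR d α f n) z) ∧
    HasVal (wallS d α f n) z (val (wallS d α f n) z) ∧
    HasVal (supstar d α n (wallR d α f n)) z (val (supstar d α n (wallR d α f n)) z) ∧
    HasVal (supstar d α n (wallS d α f n)) z (val (supstar d α n (wallS d α f n)) z) := by
  have key : ∀ {r : RatFunc ℂ} {v : ℂ}, HasVal r z v → HasVal r z (val r z) := fun h => by
    rwa [h.val_eq]
  exact wall_induction hα f (P := fun _ r => HasVal r z (val r z))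
    (fun c => key (HasVal.C c z)) (fun _ _ _ hr hs => key (hr.add hs))
    (fun _ c _ hr => key ((HasVal.C c z).mul hr)) (fun _ _ hr => hr)
    (fun n _ hr => key ((hasVal_zeta (hα _) hz).mul hr)) n

end Blaschke

/-! ### The Nevanlinna–Pick iterates and interpolation by Wall rational functions -/

section NevanlinnaPick

variable {d : Region} {α : ℕ → ℂ}

/-- The filled quotient is written with the divided slope `dslope f a`, which is analytic through
`a`. The relation is stated without division, so that it also holds at `a`, where both sides vanish.
-/
theorem npStep_spec {a : ℂ} (ha : a ∈ domain d) {f : ℂ → ℂ}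
    (hf : DifferentiableOn ℂ f (domain d)) (hlt : ∀ z ∈ domain d, ‖f z‖ < 1) :
    DifferentiableOn ℂ (npStep d a f) (domain d) ∧
    ∀ z ∈ domain d, val (zeta d a) z * npStep d a f z * (1 - conj (f a) * f z) = f z - f a := by
  have hnh := (domain_isOpen d).mem_nhds ha
  have hne : ∀ z ∈ domain d, 1 - conj (f a) * f z ≠ 0 := fun z hz =>
    one_sub_conj_mul_ne (hlt a ha) (hlt z hz).le
  set h : ℂ → ℂ := fun z =>
    dslope f a z * (val (varpi d a) z / unimod d a) / (1 - conj (f a) * f z) with hh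
  have hvarpi : DifferentiableOn ℂ (val (varpi d a)) (domain d) := by
    cases d
    · have : val (varpi .disk a) = fun z => 1 - conj a * z :=
        funext fun z => (hasVal_varpi_disk a z).val_eq
      rw [this]; fun_prop
    · have : val (varpi .halfPlane a) = fun z => z - conj a :=
        funext fun z => (hasVal_varpi_halfPlane a z).val_eq
      rw [this]; fun_prop
  have hd : DifferentiableOn ℂ h (domain d) := by
    refine DifferentiableOn.div ?_ ((hf.const_mul _).const_sub _) hne
    exact ((Complex.differentiableOn_dslope hnh).2 hf).mul (hvarpi.div_const _)
  have hu := unimod_ne_zero ha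
  have hg : ∀ z ∈ domain d, z ≠ a →
      1 / val (zeta d a) z * ((f z - f a) / (1 - conj (f a) * f z)) = h z := by
    intro z hz hza
    have h1 := val_varpi_ne_zero ha hz
    have h2 := sub_ne_zero.2 hza
    have h3 := hne z hz
    simp only [hh]
    rw [dslope_of_ne _ hza, slope_def_field, val_zeta ha hz]
    field_simp
  have hlim : limUnder (𝓝[≠] a) (fun z =>
      1 / val (zeta d a) z * ((f z - f a) / (1 - conj (f a) * f z))) = h a := by
    apply Tendsto.limUnder_eq
    have hc : Tendsto h (𝓝[≠] a) (𝓝 (h a)) :=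
      ((hd.continuousOn.continuousAt hnh).tendsto).mono_left nhdsWithin_le_nhds
    refine hc.congr' ?_
    filter_upwards [nhdsWithin_le_nhds hnh, self_mem_nhdsWithin] with z hz hza
    exact (hg z hz hza).symm
  have heq : ∀ z ∈ domain d, npStep d a f z = h z := by
    intro z hz
    by_cases hza : z = a
    · subst hza
      simp only [npStep, Function.update_self]
      exact hlim
    · simp only [npStep, Function.update_of_ne hza]
      exact hg z hz hza
  refine ⟨hd.congr heq, fun z hz => ?_⟩
  by_cases hza : z = a
  · subst hza
    simp [val_zeta_self ha]
  · rw [heq z hz, ← hg z hz hza]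
    have h1 := val_zeta_ne_zero ha hz hza
    have h3 := hne z hz
    rw [one_div, mul_inv_cancel_left₀ h1, div_mul_cancel₀ _ h3]

theorem norm_npIterate_lt {f : ℂ → ℂ} {k : ℕ} (hk : (k : ℕ∞) < npLength d α f) :
    ∀ z ∈ domain d, ‖npIterate d α f k z‖ < 1 := by
  by_contra h
  have : npLength d α f ≤ k := iInf₂_le k h
  exact absurd hk (not_lt.2 this)

variable (hα : ∀ n, α n ∈ domain d) {f : ℂ → ℂ} (hf : DifferentiableOn ℂ f (domain d))
include hα hf

theorem differentiableOn_npIterate {n : ℕ} (hn : (n : ℕ∞) ≤ npLength d α f) :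
    DifferentiableOn ℂ (npIterate d α f n) (domain d) := by
  induction n with
  | zero => exact hf
  | succ n ih =>
    have hlt : (n : ℕ∞) < npLength d α f := lt_of_lt_of_le (by exact_mod_cast n.lt_succ_self) hn
    exact (npStep_spec (hα _) (ih hlt.le) (norm_npIterate_lt hlt)).1

theorem npIterate_relation {n : ℕ} (hn : (n : ℕ∞) < npLength d α f) {z : ℂ}
    (hz : z ∈ domain d) :
    val (zeta d (α (n + 1))) z * npIterate d α f (n + 1) z *
      (1 - conj (npParam d α f n) * npIterate d α f n z) =
      npIterate d α f n z - npParam d α f n :=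
  (npStep_spec (hα _) (differentiableOn_npIterate hα hf hn.le) (norm_npIterate_lt hn)).2 z hz

omit hf in
theorem norm_npParam_lt {n : ℕ} (hn : (n : ℕ∞) < npLength d α f) : ‖npParam d α f n‖ < 1 :=
  norm_npIterate_lt hn _ (hα _)

omit hf in
theorem upsilon_pos {n : ℕ} (hn : (n : ℕ∞) < npLength d α f) : 0 < upsilon d α f n := by
  refine Finset.prod_pos fun k hk => ?_
  have hk' : (k : ℕ∞) ≤ n := by exact_mod_cast Nat.lt_succ_iff.1 (Finset.mem_range.1 hk)
  have := norm_npParam_lt hα (lt_of_le_of_lt hk' hn)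
  nlinarith [norm_nonneg (npParam d α f k)]

/-- The representation `f = (R_n + ζ_{n+1} S_n^* f_{n+1}) / (S_n + ζ_{n+1} R_n^* f_{n+1})`. -/
theorem wall_representation {n : ℕ} (hn : (n : ℕ∞) < npLength d α f) {z : ℂ}
    (hz : z ∈ domain d) :
    val (wallS d α f n) z + val (zeta d (α (n + 1))) z *
      val (supstar d α n (wallR d α f n)) z * npIterate d α f (n + 1) z ≠ 0 ∧
    val (wallR d α f n) z + val (zeta d (α (n + 1))) z *
      val (supstar d α n (wallS d α f n)) z * npIterate d α f (n + 1) z =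
    f z * (val (wallS d α f n) z + val (zeta d (α (n + 1))) z *
      val (supstar d α n (wallR d α f n)) z * npIterate d α f (n + 1) z) := by
  -- The inverted step f_k = (γ_k + x)/(1 + conj γ_k x) with x = ζ_{k+1} f_{k+1}. The denominator is
  -- nonzero, since its vanishing would force |γ_k| = 1.
  have hγ : ∀ {k : ℕ}, (k : ℕ∞) < npLength d α f →
      ∃ x, npIterate d α f k z * (1 + conj (npParam d α f k) * x) = npParam d α f k + x ∧
        1 + conj (npParam d α f k) * x ≠ 0 ∧
        x = val (zeta d (α (k + 1))) z * npIterate d α f (k + 1) z := by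
    intro k hk
    refine ⟨_, ?_, ?_, rfl⟩
    · linear_combination -npIterate_relation hα hf hk hz
    · intro h0
      have h1 := npIterate_relation hα hf hk hz
      have h2 : (1 - conj (npParam d α f k) * npParam d α f k) = 0 := by
        linear_combination (1 - conj (npParam d α f k) * npIterate d α f k z) * h0 -
          conj (npParam d α f k) * h1
      exact one_sub_conj_mul_ne (norm_npParam_lt hα hk) (norm_npParam_lt hα hk).le h2
  induction n with
  | zero =>
    obtain ⟨x, h1, h2, hx⟩ := hγ hn
    rw [supstar_wallR_zero, supstar_wallS_zero, wallR_zero, wallS_zero, (HasVal.one z).val_eq,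
      (HasVal.C _ z).val_eq, (HasVal.C _ z).val_eq]
    have h3 : npIterate d α f 0 z = f z := rfl
    rw [h3] at h1
    constructor
    · intro h; apply h2; rw [hx]; linear_combination h
    · rw [hx] at h1; linear_combination -h1
  | succ n ih =>
    have hlt : (n : ℕ∞) < npLength d α f := lt_trans (by exact_mod_cast n.lt_succ_self) hn
    obtain ⟨i1, i2⟩ := ih hlt
    obtain ⟨x, h1, h2, hx⟩ := hγ hn
    obtain ⟨vR, vS, vRs, vSs⟩ := hasVal_wall hα f n hz
    have hζ := hasVal_zeta (hα (n + 1)) hz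
    rw [supstar_wallR_succ hα, supstar_wallS_succ hα, wallR_succ, wallS_succ,
      (vR.add (((HasVal.C _ z).mul hζ).mul vSs)).val_eq,
      (vS.add (((HasVal.C _ z).mul hζ).mul vRs)).val_eq,
      ((hζ.mul vRs).add ((HasVal.C _ z).mul vS)).val_eq,
      ((hζ.mul vSs).add ((HasVal.C _ z).mul vR)).val_eq]
    generalize val (wallR d α f n) z = R at *
    generalize val (wallS d α f n) z = S at *
    generalize val (supstar d α n (wallR d α f n)) z = Rs at *
    generalize val (supstar d α n (wallS d α f n)) z = Ss at *
    generalize val (zeta d (α (n + 1))) z = ζ at *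
    generalize npIterate d α f (n + 1) z = g at *
    generalize npParam d α f (n + 1) = γ at *
    generalize val (zeta d (α (n + 1 + 1))) z = ζ' at *
    generalize npIterate d α f (n + 1 + 1) z = g' at *
    subst hx
    constructor
    · have h4 := mul_ne_zero h2 i1
      intro h; apply h4
      linear_combination h + ζ * Rs * h1
    · linear_combination (1 + conj γ * (ζ' * g')) * i2 - ζ * Ss * h1 + f z * ζ * Rs * h1

/-- The interpolation identities for `S_n^* - f R_n^*` and `f S_n - R_n`. -/
theorem wall_interpolation {n : ℕ} (hn : (n : ℕ∞) < npLength d α f) {z : ℂ}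
    (hz : z ∈ domain d) :
    (val (supstar d α n (wallS d α f n)) z - f z * val (supstar d α n (wallR d α f n)) z) *
      (val (wallS d α f n) z + val (zeta d (α (n + 1))) z *
        val (supstar d α n (wallR d α f n)) z * npIterate d α f (n + 1) z) =
      upsilon d α f n * val (blaschke d α n) z ∧
    (f z * val (wallS d α f n) z - val (wallR d α f n) z) *
      (val (wallS d α f n) z + val (zeta d (α (n + 1))) z *
        val (supstar d α n (wallR d α f n)) z * npIterate d α f (n + 1) z) =
      upsilon d α f n * (val (blaschke d α n) z * val (zeta d (α (n + 1))) z) *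
        npIterate d α f (n + 1) z := by
  obtain ⟨-, h2⟩ := wall_representation hα hf hn hz
  obtain ⟨vR, vS, vRs, vSs⟩ := hasVal_wall hα f n hz
  have hdet := (vS.mul vSs).sub (vR.mul vRs)
  rw [wall_det hα] at hdet
  have hdet2 := hdet.unique ((HasVal.C _ z).mul (hasVal_blaschke hα n hz).1)
  -- Replacing f times the denominator by the numerator of the representation cancels the cross
  -- terms and leaves the determinant.
  constructor
  · linear_combination hdet2 + val (supstar d α n (wallR d α f n)) z * h2
  · linear_combination val (zeta d (α (n + 1))) z * npIterate d α f (n + 1) z * hdet2 -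
      val (wallS d α f n) z * h2

end NevanlinnaPick

/-! ### The space of rational functions with prescribed poles -/

section RatSpace

variable {d : Region} {α : ℕ → ℂ}

/-- Division of polynomials by `ϖ_1 ⋯ ϖ_n`. -/
noncomputable def divVarpi (d : Region) (α : ℕ → ℂ) (n : ℕ) : Polynomial ℂ →ₗ[ℂ] RatFunc ℂ :=
  LinearMap.mulLeft ℂ (∏ k ∈ Finset.Icc 1 n, varpi d (α k))⁻¹ ∘ₗ
    (IsScalarTower.toAlgHom ℂ (Polynomial ℂ) (RatFunc ℂ)).toLinearMap

/-- The space of the rational functions `p / (ϖ_1 ⋯ ϖ_n)` with `deg p ≤ n`. -/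
noncomputable def ratSpace (d : Region) (α : ℕ → ℂ) (n : ℕ) : Submodule ℂ (RatFunc ℂ) :=
  (Polynomial.degreeLT ℂ (n + 1)).map (divVarpi d α n)

theorem mem_ratSpace {n : ℕ} {r : RatFunc ℂ} : r ∈ ratSpace d α n ↔
    ∃ p : Polynomial ℂ, p.degree < (n + 1 : ℕ) ∧
      (∏ k ∈ Finset.Icc 1 n, varpi d (α k))⁻¹ * algebraMap _ _ p = r := by
  simp only [ratSpace, Submodule.mem_map, Polynomial.mem_degreeLT]
  rfl

theorem C_mem_ratSpace (c : ℂ) : RatFunc.C c ∈ ratSpace d α 0 :=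
  mem_ratSpace.2 ⟨Polynomial.C c, lt_of_le_of_lt Polynomial.degree_C_le (by norm_num), by simp⟩

/-- Only the upper bound is needed: n + 1 orthonormal functions inside the space will then exhaust
it. -/
theorem finrank_ratSpace_le (n : ℕ) : Module.finrank ℂ (ratSpace d α n) ≤ n + 1 := by
  have e := (Polynomial.degreeLTEquiv ℂ (n + 1))
  have : Module.Finite ℂ (Polynomial.degreeLT ℂ (n + 1)) := Module.Finite.equiv e.symm
  refine (Submodule.finrank_map_le _ _).trans ?_
  rw [e.finrank_eq]; simp

instance (n : ℕ) : Module.Finite ℂ (ratSpace d α n) := by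
  have e := (Polynomial.degreeLTEquiv ℂ (n + 1))
  have : Module.Finite ℂ (Polynomial.degreeLT ℂ (n + 1)) := Module.Finite.equiv e.symm
  unfold ratSpace
  infer_instance

theorem C_mul_mem {M : Submodule ℂ (RatFunc ℂ)} (c : ℂ) {r : RatFunc ℂ} (h : r ∈ M) :
    RatFunc.C c * r ∈ M := by
  rw [← RatFunc.smul_eq_C_mul]; exact M.smul_mem c h

theorem affine_mul_mem_ratSpace {n : ℕ} {r : RatFunc ℂ} (hr : r ∈ ratSpace d α n) (b c : ℂ) :
    (RatFunc.C b * RatFunc.X + RatFunc.C c) / varpi d (α (n + 1)) * r ∈ ratSpace d α (n + 1) := by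
  obtain ⟨p, hp, rfl⟩ := mem_ratSpace.1 hr
  refine mem_ratSpace.2 ⟨(Polynomial.C b * Polynomial.X + Polynomial.C c) * p, ?_, ?_⟩
  · have h1 : (Polynomial.C b * Polynomial.X + Polynomial.C c).degree ≤ 1 :=
      Polynomial.degree_linear_le
    rcases eq_or_ne p 0 with rfl | h0
    · rw [mul_zero, Polynomial.degree_zero]; exact WithBot.bot_lt_coe _
    refine lt_of_le_of_lt (Polynomial.degree_mul_le _ _) ?_
    rw [Polynomial.degree_eq_natDegree h0] at hp ⊢
    have h2 : p.natDegree < n + 1 := by exact_mod_cast hp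
    refine lt_of_le_of_lt (add_le_add_left h1 _) ?_
    have : ((1 + p.natDegree : ℕ) : WithBot ℕ) < ((n + 1 + 1 : ℕ) : WithBot ℕ) := by
      exact_mod_cast (by omega : 1 + p.natDegree < n + 1 + 1)
    simpa using this
  · rw [Finset.prod_Icc_succ_top (by omega), mul_inv]
    simp only [map_mul, map_add, RatFunc.algebraMap_C, RatFunc.algebraMap_X]
    ring

theorem varpi_eq_affine (d : Region) (a : ℂ) :
    ∃ b c, varpi d a = RatFunc.C b * RatFunc.X + RatFunc.C c := by
  cases d
  · exact ⟨-conj a, 1, by simp [varpi]; ring⟩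
  · exact ⟨1, -conj a, by simp [varpi]; ring⟩

variable (hα : ∀ n, α n ∈ domain d)
include hα

theorem ratSpace_mono_succ {n : ℕ} {r : RatFunc ℂ} (hr : r ∈ ratSpace d α n) :
    r ∈ ratSpace d α (n + 1) := by
  obtain ⟨b, c, h⟩ := varpi_eq_affine d (α (n + 1))
  have := affine_mul_mem_ratSpace hr b c
  rwa [← h, div_self (varpi_ne_zero (hα _)), one_mul] at this

omit hα in
theorem ratio_mul_mem_ratSpace {n : ℕ} {r : RatFunc ℂ} (hr : r ∈ ratSpace d α n) :
    varpi d (basePoint d) / varpi d (α (n + 1)) * r ∈ ratSpace d α (n + 1) := by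
  obtain ⟨b, c, h⟩ := varpi_eq_affine d (basePoint d)
  rw [h]
  exact affine_mul_mem_ratSpace hr b c

omit hα in
theorem ratioStar_mul_mem_ratSpace {n : ℕ} {r : RatFunc ℂ} (hr : r ∈ ratSpace d α n) :
    varpi d (basePoint d) / varpi d (α (n + 1)) * (W d * r) ∈ ratSpace d α (n + 1) := by
  have h := affine_mul_mem_ratSpace hr 1 (-basePoint d)
  have h1 : RatFunc.C 1 * RatFunc.X + RatFunc.C (-basePoint d) =
      W d * varpi d (basePoint d) := by
    rw [← varpiStar_basePoint]; simp [varpiStar, sub_eq_add_neg]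
  rw [h1] at h
  convert h using 1
  ring

omit hα in
theorem zeta_mul_mem_ratSpace {n : ℕ} {r : RatFunc ℂ} (hr : r ∈ ratSpace d α n) :
    zeta d (α (n + 1)) * r ∈ ratSpace d α (n + 1) := by
  have h := C_mul_mem (unimod d (α (n + 1))) (affine_mul_mem_ratSpace hr 1 (-α (n + 1)))
  convert h using 1
  simp only [zeta, varpiStar, map_one, one_mul, map_neg, ← sub_eq_add_neg]
  ring

theorem blaschke_mem_ratSpace {k n : ℕ} (hkn : k ≤ n) : blaschke d α k ∈ ratSpace d α n := by
  induction n, hkn using Nat.le_induction with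
  | base =>
    induction k with
    | zero => rw [blaschke_zero]; simpa using C_mem_ratSpace (d := d) (α := α) 1
    | succ k ih => rw [blaschke_succ, mul_comm]; exact zeta_mul_mem_ratSpace ih
  | succ n _ ih => exact ratSpace_mono_succ hα ih

theorem span_blaschke_le (n : ℕ) :
    Submodule.span ℂ (blaschke d α '' Set.Iic n) ≤ ratSpace d α n := by
  rw [Submodule.span_le]
  rintro _ ⟨k, hk, rfl⟩
  exact blaschke_mem_ratSpace hα hk

theorem wall_mem_ratSpace (f : ℂ → ℂ) (n : ℕ) :
    wallR d α f n ∈ ratSpace d α n ∧ wallS d α f n ∈ ratSpace d α n ∧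
    supstar d α n (wallR d α f n) ∈ ratSpace d α n ∧
    supstar d α n (wallS d α f n) ∈ ratSpace d α n :=
  wall_induction hα f (P := fun n r => r ∈ ratSpace d α n) C_mem_ratSpace
    (fun _ _ _ => Submodule.add_mem _) (fun _ c _ => C_mul_mem c)
    (fun _ _ => ratSpace_mono_succ hα) (fun _ _ => zeta_mul_mem_ratSpace) n

end RatSpace

/-! ### Candidates for the orthonormal and second kind functions -/

section Candidates

variable {d : Region} {α : ℕ → ℂ} {f : ℂ → ℂ}

/-- The orthonormal function of index `m + 1` in terms of the Wall rational functions. -/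
noncomputable def wallPhi (d : Region) (α : ℕ → ℂ) (f : ℂ → ℂ) (m : ℕ) : RatFunc ℂ :=
  RatFunc.C (unimod d (α (m + 1)) / (kappa d α f (m + 1) : ℝ)) *
    (varpi d (basePoint d) / varpi d (α (m + 1)) *
      (W d * supstar d α m (wallS d α f m) - supstar d α m (wallR d α f m)))

/-- The second kind function of index `m + 1` in terms of the Wall rational functions. -/
noncomputable def wallPsi (d : Region) (α : ℕ → ℂ) (f : ℂ → ℂ) (m : ℕ) : RatFunc ℂ :=
  RatFunc.C (unimod d (α (m + 1)) / (kappa d α f (m + 1) : ℝ)) *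
    (varpi d (basePoint d) / varpi d (α (m + 1)) *
      (W d * supstar d α m (wallS d α f m) + supstar d α m (wallR d α f m)))

variable (hα : ∀ n, α n ∈ domain d)
include hα

theorem wallPhi_mem (m : ℕ) : wallPhi d α f m ∈ ratSpace d α (m + 1) := by
  obtain ⟨-, -, h3, h4⟩ := wall_mem_ratSpace hα f m
  refine C_mul_mem _ ?_
  rw [mul_sub]
  exact Submodule.sub_mem _ (ratioStar_mul_mem_ratSpace h4) (ratio_mul_mem_ratSpace h3)

theorem wallPsi_mem (m : ℕ) : wallPsi d α f m ∈ ratSpace d α (m + 1) := by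
  obtain ⟨-, -, h3, h4⟩ := wall_mem_ratSpace hα f m
  refine C_mul_mem _ ?_
  rw [mul_add]
  exact Submodule.add_mem _ (ratioStar_mul_mem_ratSpace h4) (ratio_mul_mem_ratSpace h3)

/-- The factor B_{m+1} splits as B_m ζ_{m+1}: B_m turns the substars back into `r` and `s`, while
ζ_{m+1} converts (ϖ_0/ϖ_{m+1})_* = ϖ*_0/ϖ*_{m+1} into z_{m+1} W ϖ_0/ϖ_{m+1}, and z_{m+1} cancels its
conjugate. With r = ∓R and s = S this covers both candidates. -/
theorem supstar_candidate (m : ℕ) (k : ℝ) (r s : RatFunc ℂ) :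
    supstar d α (m + 1) (RatFunc.C (unimod d (α (m + 1)) / (k : ℝ)) *
      (varpi d (basePoint d) / varpi d (α (m + 1)) *
        (W d * supstar d α m s + supstar d α m r))) =
      RatFunc.C (1 / (k : ℂ)) * (varpi d (basePoint d) / varpi d (α (m + 1)) * (s + W d * r)) := by
  have h1 := blaschke_ne_zero hα m
  have h2 := W_ne_zero d
  have h3 := varpiStar_ne_zero (α (m + 1))
  have h4 := varpi_ne_zero (hα (m + 1))
  have h5 : (RatFunc.C (unimod d (α (m + 1))) : RatFunc ℂ) ≠ 0 :=
    (map_ne_zero _).2 (unimod_ne_zero (hα _))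
  simp only [supstar, substar_eq, map_mul, map_add, substarHom_ratio (hα _), substarHom_C,
    substarHom_W, substarHom_blaschke hα, substarHom_substarHom, blaschke_succ,
    varpiStar_basePoint, map_div₀, Complex.conj_ofReal, map_one,
    C_conj_mul_C (norm_unimod (hα _)), zeta]
  field_simp

theorem supstar_wallPhi (m : ℕ) : supstar d α (m + 1) (wallPhi d α f m) =
    RatFunc.C (1 / ((kappa d α f (m + 1) : ℝ) : ℂ)) *
      (varpi d (basePoint d) / varpi d (α (m + 1)) * (wallS d α f m - W d * wallR d α f m)) := by
  have h := supstar_candidate hα m (kappa d α f (m + 1)) (-wallR d α f m) (wallS d α f m)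
  have h1 : supstar d α m (-wallR d α f m) = -supstar d α m (wallR d α f m) := by
    simp [supstar, substar_eq]
  rw [h1, ← sub_eq_add_neg, mul_neg, ← sub_eq_add_neg] at h
  exact h

theorem supstar_wallPsi (m : ℕ) : supstar d α (m + 1) (wallPsi d α f m) =
    RatFunc.C (1 / ((kappa d α f (m + 1) : ℝ) : ℂ)) *
      (varpi d (basePoint d) / varpi d (α (m + 1)) * (wallS d α f m + W d * wallR d α f m)) :=
  supstar_candidate hα m (kappa d α f (m + 1)) (wallR d α f m) (wallS d α f m)

theorem kappa_pos (hα₀ : α 0 = basePoint d) {m : ℕ} (hm : (m : ℕ∞) < npLength d α f) :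
    0 < kappa d α f (m + 1) ∧
      kappa d α f (m + 1) ^ 2 = upsilon d α f m * weightRatio d (α (m + 1)) := by
  have h : kappa d α f (m + 1) = Real.sqrt (upsilon d α f m * weightRatio d (α (m + 1))) := by
    simp [kappa, weightRatio, hα₀]
  have h1 := mul_pos (upsilon_pos hα hm) (weightRatio_eq (hα (m + 1))).1
  rw [h]
  exact ⟨Real.sqrt_pos.2 h1, Real.sq_sqrt h1.le⟩

end Candidates

/-! ### Bounded measurable functions on the boundary -/

section Bounded

variable {d : Region}

/-- The boundary values of `ζ_0`. -/
noncomputable def bdryW (t : boundary d) : ℂ := sphereVal (W d) t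

theorem norm_bdryW (t : boundary d) : ‖bdryW t‖ = 1 := (sphereVal_W t.2).2

theorem bdryW_ne_zero (t : boundary d) : bdryW t ≠ 0 := by
  intro h
  have := norm_bdryW t
  rw [h] at this; simp at this

theorem conj_bdryW (t : boundary d) : conj (bdryW t) = (bdryW t)⁻¹ := by
  apply eq_inv_of_mul_eq_one_left
  rw [Complex.conj_mul', norm_bdryW]; simp

theorem bdryW_sub_ne {x : ℂ} (hx : ‖x‖ < 1) (t : boundary d) : bdryW t - x ≠ 0 := by
  intro h
  have := norm_bdryW t
  rw [sub_eq_zero.1 h] at this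
  linarith

/-- Bounded measurable functions. -/
def BddMeas (G : boundary d → ℂ) : Prop := Measurable G ∧ ∃ C, ∀ t, ‖G t‖ ≤ C

namespace BddMeas

variable {G H : boundary d → ℂ}

theorem const (c : ℂ) : BddMeas fun _ : boundary d => c := ⟨measurable_const, ‖c‖, fun _ => le_rfl⟩

theorem add (hG : BddMeas G) (hH : BddMeas H) : BddMeas fun t => G t + H t := by
  obtain ⟨h1, C, hC⟩ := hG
  obtain ⟨h2, C', hC'⟩ := hH
  exact ⟨h1.add h2, C + C', fun t => (norm_add_le _ _).trans (add_le_add (hC t) (hC' t))⟩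

theorem mul (hG : BddMeas G) (hH : BddMeas H) : BddMeas fun t => G t * H t := by
  obtain ⟨h1, C, hC⟩ := hG
  obtain ⟨h2, C', hC'⟩ := hH
  refine ⟨h1.mul h2, C * C', fun t => ?_⟩
  rw [norm_mul]
  exact mul_le_mul (hC t) (hC' t) (norm_nonneg _) ((norm_nonneg _).trans (hC t))

theorem sub (hG : BddMeas G) (hH : BddMeas H) : BddMeas fun t => G t - H t := by
  simpa [sub_eq_add_neg] using hG.add ((const (-1)).mul hH)

theorem conjugate (hG : BddMeas G) : BddMeas fun t => starRingEnd ℂ (G t) := by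
  obtain ⟨h1, C, hC⟩ := hG
  exact ⟨Complex.continuous_conj.measurable.comp h1, C, fun t => by
    rw [RCLike.norm_conj]; exact hC t⟩

theorem inv (hG : Measurable G) {C : ℝ} (hc : 0 < C) (h : ∀ t, C ≤ ‖G t‖) :
    BddMeas fun t => (G t)⁻¹ :=
  ⟨hG.inv, C⁻¹, fun t => by rw [norm_inv]; exact inv_anti₀ hc (h t)⟩

theorem integrable (hG : BddMeas G) (μ : Measure (boundary d)) [IsProbabilityMeasure μ] :
    Integrable G μ := by
  obtain ⟨h1, C, hC⟩ := hG
  exact Integrable.of_bound h1.aestronglyMeasurable C (Eventually.of_forall hC)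

theorem sphereVal_of_bound {r : RatFunc ℂ} {C : ℝ}
    (h : ∀ t : boundary d, ‖sphereVal r t‖ ≤ C) :
    BddMeas fun t : boundary d => sphereVal r t :=
  ⟨(measurable_sphereVal r).comp measurable_subtype_coe, C, h⟩

theorem bdryW : BddMeas (bdryW (d := d)) :=
  sphereVal_of_bound fun t => (norm_bdryW t).le

theorem cauchyKernel {x : ℂ} (hx : ‖x‖ < 1) :
    BddMeas fun t : boundary d => (WallORF.bdryW t - x)⁻¹ := by
  refine inv (C := 1 - ‖x‖) (bdryW.sub (const x)).1 (by linarith) fun t => ?_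
  have := norm_sub_norm_le (WallORF.bdryW t) x
  rwa [norm_bdryW] at this

theorem szegoKernel {x : ℂ} (hx : ‖x‖ < 1) :
    BddMeas fun t : boundary d => (1 - starRingEnd ℂ x * WallORF.bdryW t)⁻¹ := by
  refine inv (C := 1 - ‖x‖) ((const 1).sub ((const _).mul bdryW)).1 (by linarith)
    fun t => ?_
  have := norm_sub_norm_le 1 (starRingEnd ℂ x * WallORF.bdryW t)
  rwa [norm_mul, RCLike.norm_conj, norm_bdryW, norm_one, mul_one] at this

end BddMeas

theorem kernelD_eq {z : ℂ} (hz : z ∈ domain d) (t : boundary d) :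
    kernelD d t z = 1 + 2 * omega d z * (bdryW t - omega d z)⁻¹ := by
  have h := bdryW_sub_ne (norm_omega_lt hz) t
  have h1 : kernelD d t z = (bdryW t + omega d z) / (bdryW t - omega d z) := rfl
  rw [h1]
  field_simp
  ring

theorem BddMeas.kernelD {z : ℂ} (hz : z ∈ domain d) :
    BddMeas fun t : boundary d => WallORF.kernelD d t z := by
  simp_rw [kernelD_eq hz]
  exact (const 1).add ((const _).mul (cauchyKernel (norm_omega_lt hz)))

end Bounded

/-! ### Cauchy transforms in the variable ζ_0 and the Schur relation -/

section Cauchy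

variable {d : Region} {μ : Measure (boundary d)} [IsProbabilityMeasure μ]

/-- The Cauchy transform of `G μ` in the variable `ζ_0`. -/
noncomputable def cauchyT (μ : Measure (boundary d)) (G : boundary d → ℂ) (x : ℂ) : ℂ :=
  ∫ t, (bdryW t - x)⁻¹ * G t ∂μ

theorem continuousOn_cauchyT {G : boundary d → ℂ} (hG : BddMeas G) :
    ContinuousOn (fun z => cauchyT μ G (omega d z)) (domain d) := by
  have h : ∀ x ∈ {x : ℂ | ‖x‖ < 1}, ContinuousAt (cauchyT μ G) x := by
    intro x hx
    obtain ⟨r, hxr, hr⟩ := exists_between (show ‖x‖ < 1 from hx)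
    obtain ⟨-, C, hC⟩ := id hG
    have hev : ∀ᶠ y in 𝓝 x, ‖y‖ < r := (isOpen_lt continuous_norm continuous_const).mem_nhds hxr
    refine continuousAt_of_dominated (bound := fun _ => (1 - r)⁻¹ * C) ?_ ?_
      (integrable_const _) ?_
    · filter_upwards [hev] with y hy
      exact ((BddMeas.cauchyKernel (hy.trans hr)).mul hG).1.aestronglyMeasurable
    · filter_upwards [hev] with y hy
      refine Eventually.of_forall fun t => ?_
      rw [norm_mul, norm_inv]
      have h1 := norm_sub_norm_le (bdryW t) y
      rw [norm_bdryW] at h1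
      have h2 : ‖bdryW t - y‖⁻¹ ≤ (1 - r)⁻¹ := inv_anti₀ (by linarith) (by linarith)
      exact mul_le_mul h2 (hC t) (norm_nonneg _) (inv_nonneg.2 (by linarith))
    · refine Eventually.of_forall fun t => ?_
      refine ContinuousAt.mul ?_ continuousAt_const
      exact (continuousAt_const.sub continuousAt_id).inv₀ (bdryW_sub_ne hx t)
  intro z hz
  exact (h _ (norm_omega_lt hz)).comp_continuousWithinAt (continuousOn_omega d z hz)

/-- The kernel is 1 + 2x/(w - x) with w, x the values of ζ_0 at t and z, so Herglotz-type integrals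
reduce to a mean and a Cauchy transform. -/
theorem integral_kernelD_mul {G : boundary d → ℂ} (hG : BddMeas G) {z : ℂ} (hz : z ∈ domain d) :
    ∫ t : boundary d, kernelD d t z * G t ∂μ =
      ∫ t, G t ∂μ + 2 * omega d z * cauchyT μ G (omega d z) := by
  simp_rw [kernelD_eq hz, add_mul, one_mul, mul_assoc]
  rw [integral_add (hG.integrable μ), integral_const_mul, integral_const_mul]
  · rfl
  · exact ((BddMeas.const _).mul ((BddMeas.const _).mul
      ((BddMeas.cauchyKernel (norm_omega_lt hz)).mul hG))).integrable μ

theorem integral_kernelD_mul_sub {G : boundary d → ℂ} (hG : BddMeas G) (c : ℂ) {z : ℂ}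
    (hz : z ∈ domain d) :
    ∫ t : boundary d, kernelD d t z * (G t - c) ∂μ =
      ∫ t : boundary d, kernelD d t z * G t ∂μ - cFun d μ z * c := by
  simp_rw [mul_sub]
  rw [integral_sub (((BddMeas.kernelD hz).mul hG).integrable μ)
    (((BddMeas.kernelD hz).mul (BddMeas.const c)).integrable μ), integral_mul_const]
  rfl

/-- The kernel has nonnegative real part because |ζ_0(t)| = 1 and |ζ_0(z)| < 1, hence Re F ≥ 0. -/
theorem cFun_add_one_ne {z : ℂ} (hz : z ∈ domain d) : cFun d μ z + 1 ≠ 0 := by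
  intro h
  have h1 : 0 ≤ (cFun d μ z).re := by
    have h2 := integral_re ((BddMeas.kernelD hz).integrable μ)
    have h3 : (cFun d μ z).re = RCLike.re (∫ t : boundary d, kernelD d t z ∂μ) := rfl
    rw [h3, ← h2]
    refine integral_nonneg fun t => ?_
    have h4 : kernelD d t z = (bdryW t + omega d z) / (bdryW t - omega d z) := rfl
    have h5 := norm_bdryW t
    have h6 := norm_omega_lt hz
    change 0 ≤ (kernelD d t z).re
    rw [h4, Complex.div_re, ← add_div]
    refine div_nonneg ?_ (Complex.normSq_nonneg _)
    have h7 : Complex.normSq (bdryW t) = 1 := by rw [Complex.normSq_eq_norm_sq, h5]; norm_num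
    have h8 : Complex.normSq (omega d z) ≤ 1 := by
      rw [Complex.normSq_eq_norm_sq]; nlinarith [norm_nonneg (omega d z)]
    rw [Complex.normSq_apply] at h7 h8
    simp only [Complex.add_re, Complex.sub_re, Complex.add_im, Complex.sub_im]
    nlinarith
  have h2 := congrArg Complex.re h
  simp at h2
  linarith

theorem cFun_basePoint : cFun d μ (basePoint d) = 1 := by
  unfold cFun
  simp_rw [kernelD_eq (basePoint_mem d), omega_basePoint]
  simp

theorem schur_relation {f : ℂ → ℂ} (hf : IsSchurFunOf d μ f) {z : ℂ} (hz : z ∈ domain d) :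
    1 - omega d z * f z ≠ 0 ∧
      cFun d μ z * (1 - omega d z * f z) = 1 + omega d z * f z := by
  constructor
  · intro h
    have h1 : ‖omega d z * f z‖ = 1 := by rw [← sub_eq_zero.1 h]; simp
    rw [norm_mul] at h1
    nlinarith [hf.1.2 z hz, norm_omega_lt hz, norm_nonneg (f z), norm_nonneg (omega d z)]
  · by_cases hzb : z = basePoint d
    · subst hzb; simp [cFun_basePoint, omega_basePoint]
    · have h1 := hf.2 z hz hzb
      have h2 : val (zeta d (basePoint d)) z = omega d z := rfl
      have h3 : omega d z ≠ 0 := fun h =>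
        hzb (omega_injOn d hz (basePoint_mem d) (by rw [h, omega_basePoint]))
      have h4 := cFun_add_one_ne (μ := μ) hz
      rw [h2] at h1
      rw [h1]
      field_simp
      ring

end Cauchy

/-! ### Boundary values of rational functions without boundary poles -/

section BoundaryValues

variable {d : Region} {α : ℕ → ℂ}

/-- Rational functions without poles on the boundary. -/
def BdryReg (d : Region) (r : RatFunc ℂ) : Prop :=
  (∀ t : boundary d, HasSVal r t (sphereVal r t)) ∧ BddMeas fun t : boundary d => sphereVal r t

theorem BdryReg.add {r s : RatFunc ℂ} (hr : BdryReg d r) (hs : BdryReg d s) :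
    BdryReg d (r + s) ∧ ∀ t : boundary d, sphereVal (r + s) t = sphereVal r t + sphereVal s t := by
  have h : ∀ t : boundary d, sphereVal (r + s) t = sphereVal r t + sphereVal s t := fun t =>
    ((hr.1 t).add (hs.1 t)).val_eq
  refine ⟨⟨fun t => h t ▸ (hr.1 t).add (hs.1 t), ?_⟩, h⟩
  simp_rw [h]
  exact hr.2.add hs.2

theorem BdryReg.smul {r : RatFunc ℂ} (c : ℂ) (hr : BdryReg d r) :
    BdryReg d (c • r) ∧ ∀ t : boundary d, sphereVal (c • r) t = c * sphereVal r t := by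
  rw [RatFunc.smul_eq_C_mul]
  have h : ∀ t : boundary d, sphereVal (RatFunc.C c * r) t = c * sphereVal r t := fun t =>
    ((HasSVal.C c t).mul (hr.1 t)).val_eq
  refine ⟨⟨fun t => h t ▸ (HasSVal.C c t).mul (hr.1 t), ?_⟩, h⟩
  simp_rw [h]
  exact (BddMeas.const c).mul hr.2

theorem BdryReg.zero : BdryReg d 0 ∧ ∀ t : boundary d, sphereVal 0 t = 0 := by
  have h : ∀ t : boundary d, sphereVal 0 t = 0 := fun t => (HasSVal.zero t).val_eq
  refine ⟨⟨fun t => h t ▸ HasSVal.zero t, ?_⟩, h⟩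
  simp_rw [h]
  exact BddMeas.const 0

theorem hasSVal_zeta {a : ℂ} (ha : a ∈ domain d) (t : boundary d) :
    HasSVal (zeta d a) t (rot d a *
      ((bdryW t - omega d a) * (1 - conj (omega d a) * bdryW t)⁻¹)) := by
  rw [zeta_eq ha]
  have hW : HasSVal (W d) t (bdryW t) := (sphereVal_W t.2).1
  exact (HasSVal.C _ _).mul ((hW.sub (HasSVal.C _ _)).mul
    (((HasSVal.one _).sub ((HasSVal.C _ _).mul hW)).inv
      (one_sub_conj_mul_ne (norm_omega_lt ha) (norm_bdryW t).le)))

theorem norm_sphereVal_zeta {a : ℂ} (ha : a ∈ domain d) (t : boundary d) :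
    ‖rot d a * ((bdryW t - omega d a) * (1 - conj (omega d a) * bdryW t)⁻¹)‖ = 1 := by
  have h1 : 1 - conj (omega d a) * bdryW t = bdryW t * conj (bdryW t - omega d a) := by
    rw [map_sub, conj_bdryW, mul_sub, mul_inv_cancel₀ (bdryW_ne_zero t)]; ring
  have h2 := norm_ne_zero_iff.2 (bdryW_sub_ne (norm_omega_lt ha) t)
  rw [h1, norm_mul, norm_rot ha, norm_mul, norm_inv, norm_mul, norm_bdryW, RCLike.norm_conj]
  field_simp

variable (hα : ∀ n, α n ∈ domain d)
include hα

theorem bdryReg_blaschke (n : ℕ) : BdryReg d (blaschke d α n) ∧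
    (∀ t : boundary d, ‖sphereVal (blaschke d α n) t‖ = 1) ∧
    ∀ t : boundary d, sphereVal (blaschke d α (n + 1)) t = sphereVal (blaschke d α n) t *
      (rot d (α (n + 1)) * ((bdryW t - omega d (α (n + 1))) *
        (1 - conj (omega d (α (n + 1))) * bdryW t)⁻¹)) := by
  have key : ∀ n, ∀ t : boundary d, HasSVal (blaschke d α n) t (sphereVal (blaschke d α n) t) ∧
      ‖sphereVal (blaschke d α n) t‖ = 1 := by
    intro n t
    induction n with
    | zero =>
      rw [blaschke_zero, (HasSVal.one (t : OnePoint ℂ)).val_eq]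
      exact ⟨HasSVal.one _, norm_one⟩
    | succ n ih =>
      rw [blaschke_succ, (ih.1.mul (hasSVal_zeta (hα (n + 1)) t)).val_eq]
      refine ⟨ih.1.mul (hasSVal_zeta (hα (n + 1)) t), ?_⟩
      rw [norm_mul, ih.2, norm_sphereVal_zeta (hα _), one_mul]
  refine ⟨⟨fun t => (key n t).1, BddMeas.sphereVal_of_bound fun t => (key n t).2.le⟩,
    fun t => (key n t).2, fun t => ?_⟩
  rw [blaschke_succ, ((key n t).1.mul (hasSVal_zeta (hα (n + 1)) t)).val_eq]

theorem bdryReg_of_mem_span {s : Set ℕ} {r : RatFunc ℂ}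
    (hr : r ∈ Submodule.span ℂ (blaschke d α '' s)) : BdryReg d r := by
  induction hr using Submodule.span_induction with
  | mem x hx =>
    obtain ⟨k, -, rfl⟩ := hx
    exact (bdryReg_blaschke hα k).1
  | zero => exact BdryReg.zero.1
  | add x y _ _ hx hy => exact (hx.add hy).1
  | smul c x _ hx => exact (hx.smul c).1

end BoundaryValues

/-! ### Existence of second kind functions and their substar conjugates -/

section SecondKind

variable {d : Region} {α : ℕ → ℂ} {μ : Measure (boundary d)} [IsProbabilityMeasure μ]

/-- The rational function `P` represents the second kind integral of `g` and, off the zeros of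
`B_n`, its substar conjugate represents the substar conjugate of that integral. -/
structure IsSecondKindOf (α : ℕ → ℂ) (μ : Measure (boundary d)) (n : ℕ) (g P : RatFunc ℂ) :
    Prop where
  mem : P ∈ ratSpace d α n
  reg : BdryReg d g
  hasVal : ∀ z ∈ domain d, HasVal g z (val g z)
  hasVal_star : ∀ z ∈ domain d, (∀ k ∈ Finset.Icc 1 n, z ≠ α k) →
    HasVal (substarHom d g) z (val (substarHom d g) z)
  integral : ∀ z ∈ domain d, HasVal P z
    (∫ t : boundary d, kernelD d t z * (sphereVal g t - val g z) ∂μ)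
  integral_star : ∀ z ∈ domain d, (∀ k ∈ Finset.Icc 1 n, z ≠ α k) →
    HasVal (substarHom d P) z (-∫ t : boundary d, kernelD d t z *
      (conj (sphereVal g t) - val (substarHom d g) z) ∂μ)

namespace IsSecondKindOf

variable {n : ℕ} {g h P Q : RatFunc ℂ}

theorem add (hg : IsSecondKindOf α μ n g P) (hh : IsSecondKindOf α μ n h Q) :
    IsSecondKindOf α μ n (g + h) (P + Q) where
  mem := Submodule.add_mem _ hg.mem hh.mem
  reg := (hg.reg.add hh.reg).1
  hasVal z hz := by
    have h1 := (hg.hasVal z hz).add (hh.hasVal z hz)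
    rwa [h1.val_eq]
  hasVal_star z hz hz' := by
    have h1 := (hg.hasVal_star z hz hz').add (hh.hasVal_star z hz hz')
    rwa [map_add, h1.val_eq]
  integral z hz := by
    convert (hg.integral z hz).add (hh.integral z hz) using 1
    rw [← integral_add
      (((BddMeas.kernelD hz).mul (hg.reg.2.sub (BddMeas.const _))).integrable μ)
      (((BddMeas.kernelD hz).mul (hh.reg.2.sub (BddMeas.const _))).integrable μ)]
    congr 1
    funext t
    rw [(hg.reg.add hh.reg).2, ((hg.hasVal z hz).add (hh.hasVal z hz)).val_eq]
    ring
  integral_star z hz hz' := by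
    rw [map_add]
    convert (hg.integral_star z hz hz').add (hh.integral_star z hz hz') using 1
    rw [← neg_add, ← integral_add
      (((BddMeas.kernelD hz).mul (hg.reg.2.conjugate.sub (BddMeas.const _))).integrable μ)
      (((BddMeas.kernelD hz).mul (hh.reg.2.conjugate.sub (BddMeas.const _))).integrable μ)]
    congr 2
    funext t
    rw [(hg.reg.add hh.reg).2, map_add, map_add,
      ((hg.hasVal_star z hz hz').add (hh.hasVal_star z hz hz')).val_eq]
    ring

omit [IsProbabilityMeasure μ] in
theorem smul (c : ℂ) (hg : IsSecondKindOf α μ n g P) :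
    IsSecondKindOf α μ n (c • g) (c • P) where
  mem := Submodule.smul_mem _ c hg.mem
  reg := (hg.reg.smul c).1
  hasVal z hz := by
    have h1 := (HasVal.C c z).mul (hg.hasVal z hz)
    rwa [RatFunc.smul_eq_C_mul, h1.val_eq]
  hasVal_star z hz hz' := by
    have h1 := (HasVal.C (conj c) z).mul (hg.hasVal_star z hz hz')
    rwa [RatFunc.smul_eq_C_mul, map_mul, substarHom_C, h1.val_eq]
  integral z hz := by
    have h1 := (HasVal.C c z).mul (hg.integral z hz)
    rw [show c • P = RatFunc.C c * P from RatFunc.smul_eq_C_mul c P]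
    convert h1 using 1
    rw [← integral_const_mul]
    congr 1
    funext t
    rw [(hg.reg.smul c).2, RatFunc.smul_eq_C_mul,
      ((HasVal.C c z).mul (hg.hasVal z hz)).val_eq]
    ring
  integral_star z hz hz' := by
    have h1 := (HasVal.C (conj c) z).mul (hg.integral_star z hz hz')
    rw [show c • P = RatFunc.C c * P from RatFunc.smul_eq_C_mul c P, map_mul, substarHom_C]
    convert h1 using 1
    rw [mul_neg, ← integral_const_mul]
    congr 2
    funext t
    rw [(hg.reg.smul c).2, RatFunc.smul_eq_C_mul, map_mul, map_mul, substarHom_C,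
      ((HasVal.C (conj c) z).mul (hg.hasVal_star z hz hz')).val_eq]
    ring

omit [IsProbabilityMeasure μ] in
theorem zero : IsSecondKindOf α μ n 0 0 where
  mem := Submodule.zero_mem _
  reg := BdryReg.zero.1
  hasVal z hz := by rw [(HasVal.zero z).val_eq]; exact HasVal.zero z
  hasVal_star z hz _ := by rw [map_zero, (HasVal.zero z).val_eq]; exact HasVal.zero z
  integral z hz := by
    simp only [BdryReg.zero.2, (HasVal.zero z).val_eq]
    simpa using HasVal.zero z
  integral_star z hz _ := by
    simp only [BdryReg.zero.2, map_zero, (HasVal.zero z).val_eq]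
    simpa using HasVal.zero z

omit [IsProbabilityMeasure μ] in
theorem mono (hα : ∀ n, α n ∈ domain d) (hg : IsSecondKindOf α μ n g P) :
    IsSecondKindOf α μ (n + 1) g P where
  mem := ratSpace_mono_succ hα hg.mem
  reg := hg.reg
  hasVal := hg.hasVal
  hasVal_star z hz hz' := hg.hasVal_star z hz fun k hk =>
    hz' k (Finset.Icc_subset_Icc_right n.le_succ hk)
  integral := hg.integral
  integral_star z hz hz' := hg.integral_star z hz fun k hk =>
    hz' k (Finset.Icc_subset_Icc_right n.le_succ hk)

/-- Split B_{n+1}(t) - B_{n+1}(z) as ζ(z)(B_n(t) - B_n(z)) + B_n(t)(ζ(t) - ζ(z)), with ζ = ζ_{n+1}.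
In the second term the difference of Möbius values cancels the pole of the kernel D(t,z). -/
theorem blaschke_succ (hα : ∀ n, α n ∈ domain d)
    (hg : IsSecondKindOf α μ n (blaschke d α n) P) :
    ∃ Q, IsSecondKindOf α μ (n + 1) (blaschke d α (n + 1)) Q := by
  obtain ⟨hreg, -, hsv⟩ := bdryReg_blaschke hα n
  have ha := norm_omega_lt (hα (n + 1))
  have hu : rot d (α (n + 1)) ≠ 0 := by
    intro h; have := norm_rot (hα (n + 1)); rw [h] at this; simp at this
  have huc : conj (rot d (α (n + 1))) = (rot d (α (n + 1)))⁻¹ := by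
    apply eq_inv_of_mul_eq_one_left
    rw [Complex.conj_mul', norm_rot (hα _)]; simp
  set a := omega d (α (n + 1)) with haa
  set u := rot d (α (n + 1)) with huu
  set b : boundary d → ℂ := fun t => sphereVal (blaschke d α n) t with hb
  set c : ℂ := u * (1 - conj a * a) with hc
  have hK := BddMeas.szegoKernel (d := d) ha
  set G₀ : boundary d → ℂ := fun t => c * (1 - conj a * bdryW t)⁻¹ * b t with hG₀
  set G₁ : boundary d → ℂ := fun t => bdryW t * G₀ t with hG₁
  have bG₀ : BddMeas G₀ := ((BddMeas.const c).mul hK).mul hreg.2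
  have bG₁ : BddMeas G₁ := BddMeas.bdryW.mul bG₀
  set A₀ : ℂ := ∫ t, G₀ t ∂μ with hA₀
  set A₁ : ℂ := ∫ t, G₁ t ∂μ with hA₁
  have hC : ∀ c : ℂ, RatFunc.C c ∈ ratSpace d α n := fun c => by
    have : ∀ n, RatFunc.C c ∈ ratSpace d α n := fun n => by
      induction n with
      | zero => exact C_mem_ratSpace c
      | succ n ih => exact ratSpace_mono_succ hα ih
    exact this n
  -- With w = ζ_0(t) and x = ζ_0(z), D(t,z)(ζ(t) - ζ(z)) equals c (w + x)/((1 - conj a w)(1 - conj a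
  -- x)). Integrating against B_n(t) separates the variables: A₁ is the moment containing w, and A₀
  -- multiplies x.
  refine ⟨zeta d (α (n + 1)) * P + (1 - RatFunc.C (conj a) * W d)⁻¹ *
    (RatFunc.C A₁ + W d * RatFunc.C A₀), ?_, (bdryReg_blaschke hα (n + 1)).1,
    fun z hz => (hasVal_blaschke hα (n + 1) hz).1, ?_, ?_, ?_⟩
  · refine Submodule.add_mem _ (zeta_mul_mem_ratSpace hg.mem) ?_
    have hv : (RatFunc.C (ratioConst d (α (n + 1))) : RatFunc ℂ) ≠ 0 :=
      (map_ne_zero _).2 (ratioConst_ne_zero (hα _))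
    have h1 : (1 - RatFunc.C (conj a) * W d)⁻¹ * (RatFunc.C A₁ + W d * RatFunc.C A₀) =
        RatFunc.C (ratioConst d (α (n + 1)))⁻¹ *
          (varpi d (basePoint d) / varpi d (α (n + 1)) * RatFunc.C A₁ +
            varpi d (basePoint d) / varpi d (α (n + 1)) * (W d * RatFunc.C A₀)) := by
      rw [one_sub_omega_mul_W (hα (n + 1)), map_inv₀, ← haa]
      field_simp
    rw [h1]
    exact C_mul_mem _ (Submodule.add_mem _ (ratio_mul_mem_ratSpace (hC _))
      (ratioStar_mul_mem_ratSpace (hC _)))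
  · intro z hz hz'
    obtain ⟨v, h1⟩ : ∃ v, HasVal (substarHom d (blaschke d α (n + 1))) z v := by
      rw [substarHom_blaschke hα]
      refine ⟨_, (hasVal_blaschke hα (n + 1) hz).1.inv ?_⟩
      rw [(hasVal_blaschke hα (n + 1) hz).2]
      exact Finset.prod_ne_zero_iff.2 fun k hk => val_zeta_ne_zero (hα k) hz (hz' k hk)
    rwa [h1.val_eq]
  · intro z hz
    have h1 := one_sub_conj_omega_ne (hα (n + 1)) hz
    have h2 := ((hasVal_zeta (hα (n + 1)) hz).mul (hg.integral z hz)).add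
      (((hasVal_one_sub (conj a) hz).inv h1).mul
        ((HasVal.C A₁ z).add ((hasVal_W hz).mul (HasVal.C A₀ z))))
    convert h2 using 1
    have i1 := ((BddMeas.kernelD hz).mul
      (hreg.2.sub (BddMeas.const (val (blaschke d α n) z)))).integrable μ
    rw [hA₁, hA₀, ← integral_const_mul, ← integral_const_mul, ← integral_add (bG₁.integrable μ)
      (((BddMeas.const _).mul bG₀).integrable μ), ← integral_const_mul,
      ← integral_add (i1.const_mul _)
      (((BddMeas.const _).mul (bG₁.add ((BddMeas.const _).mul bG₀))).integrable μ)]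
    congr 1
    funext t
    have hval : val (blaschke d α (n + 1)) z =
        val (blaschke d α n) z * val (zeta d (α (n + 1))) z := by
      rw [WallORF.blaschke_succ]
      exact ((hasVal_blaschke hα n hz).1.mul (hasVal_zeta (hα _) hz)).val_eq
    have h3 := bdryW_sub_ne (norm_omega_lt hz) t
    have h4 := one_sub_conj_mul_ne ha (norm_bdryW t).le
    rw [hsv, hval, val_zeta_omega (hα _) hz, kernelD_eq hz]
    simp only [hG₁, hG₀, hb, hc]
    rw [← haa] at h1 ⊢
    rw [← huu]
    generalize sphereVal (blaschke d α n) t = B at *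
    generalize val (blaschke d α n) z = B' at *
    generalize omega d z = x at *
    generalize bdryW t = w at *
    clear_value a u
    generalize conj a = a' at *
    obtain ⟨q, hq⟩ : ∃ q, q = 1 - a' * w := ⟨_, rfl⟩
    obtain ⟨q', hq'⟩ : ∃ q', q' = 1 - a' * x := ⟨_, rfl⟩
    rw [← hq'] at h1
    simp only [← hq, ← hq'] at h4 ⊢
    field_simp
    simp only [hq, hq']
    ring
  · intro z hz hz'
    have hz'' : ∀ k ∈ Finset.Icc 1 n, z ≠ α k := fun k hk =>
      hz' k (Finset.Icc_subset_Icc_right n.le_succ hk)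
    have hza : z ≠ α (n + 1) := hz' _ (Finset.mem_Icc.2 ⟨by omega, le_rfl⟩)
    have hxa : omega d z - a ≠ 0 := sub_ne_zero.2 fun h => hza (omega_injOn d hz (hα _) h)
    have h1 := one_sub_conj_omega_ne (hα (n + 1)) hz
    have h0 := val_zeta_ne_zero (hα (n + 1)) hz hza
    have h2 := (((hasVal_zeta (hα (n + 1)) hz).inv h0).mul (hg.integral_star z hz hz'')).add
      ((((hasVal_W hz).sub (HasVal.C a z)).inv hxa).mul
        (((hasVal_W hz).mul (HasVal.C (conj A₁) z)).add (HasVal.C (conj A₀) z)))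
    -- Since substar inverts both ζ_{n+1} and W, it produces poles at α_{n+1}; this is why the
    -- conjugate identity is claimed only off the nodes.
    have hσ : substarHom d (zeta d (α (n + 1)) * P + (1 - RatFunc.C (conj a) * W d)⁻¹ *
        (RatFunc.C A₁ + W d * RatFunc.C A₀)) = (zeta d (α (n + 1)))⁻¹ * substarHom d P +
        (W d - RatFunc.C a)⁻¹ * (W d * RatFunc.C (conj A₁) + RatFunc.C (conj A₀)) := by
      simp only [map_add, map_mul, map_inv₀, map_sub, map_one, substarHom_zeta (hα _),
        substarHom_C, substarHom_W, Complex.conj_conj]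
      have hW := W_ne_zero d
      have hWa := W_sub_C_ne d a
      have : 1 - RatFunc.C a * (W d)⁻¹ = (W d - RatFunc.C a) * (W d)⁻¹ := by field_simp
      rw [this]
      field_simp
    rw [hσ]
    convert h2 using 1
    have i1 := ((BddMeas.kernelD hz).mul
      (hreg.2.conjugate.sub (BddMeas.const (val (substarHom d (blaschke d α n)) z)))).integrable μ
    rw [hA₁, hA₀, ← integral_conj, ← integral_conj, ← integral_const_mul,
      ← integral_add (((BddMeas.const _).mul bG₁.conjugate).integrable μ) (bG₀.conjugate.integrable μ),
      ← integral_const_mul, mul_neg, ← integral_const_mul, ← sub_eq_neg_add, neg_eq_iff_eq_neg,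
      neg_sub, ← integral_sub (i1.const_mul _)
      (((BddMeas.const _).mul (((BddMeas.const _).mul bG₁.conjugate).add bG₀.conjugate)).integrable μ)]
    congr 1
    funext t
    have hval : val (substarHom d (blaschke d α (n + 1))) z =
        val (substarHom d (blaschke d α n)) z * (val (zeta d (α (n + 1))) z)⁻¹ := by
      rw [WallORF.blaschke_succ, map_mul, substarHom_zeta (hα _)]
      exact ((hg.hasVal_star z hz hz'').mul ((hasVal_zeta (hα _) hz).inv h0)).val_eq
    have h3 := bdryW_sub_ne (norm_omega_lt hz) t
    have h4 := bdryW_sub_ne ha t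
    have h5 := bdryW_ne_zero t
    have h6 : 1 - a * (bdryW t)⁻¹ = (bdryW t - a) * (bdryW t)⁻¹ := by field_simp
    have h7 : (bdryW t)⁻¹ - conj a = (1 - conj a * bdryW t) * (bdryW t)⁻¹ := by field_simp
    rw [hsv, hval, val_zeta_omega (hα _) hz, kernelD_eq hz]
    simp only [hG₁, hG₀, hb, hc, map_mul, map_sub, map_inv₀, map_one, conj_bdryW, huc,
      Complex.conj_conj]
    rw [← haa] at h1 ⊢
    rw [← huu, h6, h7]
    generalize conj (sphereVal (blaschke d α n) t) = B at *
    generalize val (substarHom d (blaschke d α n)) z = B' at *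
    generalize omega d z = x at *
    generalize bdryW t = w at *
    clear_value a u
    generalize conj a = a' at *
    obtain ⟨q, hq⟩ : ∃ q, q = 1 - a' * w := ⟨_, rfl⟩
    obtain ⟨q', hq'⟩ : ∃ q', q' = 1 - a' * x := ⟨_, rfl⟩
    rw [← hq'] at h1
    simp only [← hq, ← hq'] at h4 ⊢
    field_simp
    simp only [hq, hq']
    ring

omit [IsProbabilityMeasure μ] in
theorem blaschke_zero : IsSecondKindOf α μ 0 (blaschke d α 0) 0 where
  mem := Submodule.zero_mem _
  reg := by
    have h : ∀ t : boundary d, sphereVal 1 t = 1 := fun t => (HasSVal.one _).val_eq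
    rw [WallORF.blaschke_zero]
    refine ⟨fun t => h t ▸ HasSVal.one _, ?_⟩
    simp_rw [h]
    exact BddMeas.const 1
  hasVal z hz := by
    rw [WallORF.blaschke_zero, (HasVal.one z).val_eq]; exact HasVal.one z
  hasVal_star z hz _ := by
    rw [WallORF.blaschke_zero, map_one, (HasVal.one z).val_eq]; exact HasVal.one z
  integral z hz := by
    have h : ∀ t : boundary d, sphereVal 1 t = 1 := fun t => (HasSVal.one _).val_eq
    simp only [WallORF.blaschke_zero, h, (HasVal.one z).val_eq]
    simpa using HasVal.zero z
  integral_star z hz _ := by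
    have h : ∀ t : boundary d, sphereVal 1 t = 1 := fun t => (HasSVal.one _).val_eq
    simp only [WallORF.blaschke_zero, map_one, map_zero, h, (HasVal.one z).val_eq]
    simpa using HasVal.zero z

theorem exists_of_mem_span (hα : ∀ n, α n ∈ domain d)
    (hg : g ∈ Submodule.span ℂ (blaschke d α '' Set.Iic n)) :
    ∃ P, IsSecondKindOf α μ n g P := by
  have hb : ∀ k, ∃ P, IsSecondKindOf α μ k (blaschke d α k) P := fun k => by
    induction k with
    | zero => exact ⟨0, blaschke_zero⟩
    | succ k ih => obtain ⟨P, hP⟩ := ih; exact hP.blaschke_succ hα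
  induction hg using Submodule.span_induction with
  | mem x hx =>
    obtain ⟨k, hk, rfl⟩ := hx
    have hk' : k ≤ n := hk
    obtain ⟨P, hP⟩ := hb k
    refine ⟨P, ?_⟩
    clear hk
    induction n, hk' using Nat.le_induction with
    | base => exact hP
    | succ n _ ih => exact ih.mono hα
  | zero => exact ⟨0, zero⟩
  | add x y _ _ hx hy =>
    obtain ⟨P, hP⟩ := hx
    obtain ⟨Q, hQ⟩ := hy
    exact ⟨P + Q, hP.add hQ⟩
  | smul c x _ hx =>
    obtain ⟨P, hP⟩ := hx
    exact ⟨c • P, hP.smul c⟩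

end IsSecondKindOf

end SecondKind

/-! ### Superstars on the span of Blaschke products -/

section Supstar

variable {d : Region} {α : ℕ → ℂ}

theorem supstar_succ (n : ℕ) (r : RatFunc ℂ) :
    supstar d α (n + 1) r = zeta d (α (n + 1)) * supstar d α n r := by
  rw [supstar, supstar, blaschke_succ]; ring

theorem supstar_add (n : ℕ) (r s : RatFunc ℂ) :
    supstar d α n (r + s) = supstar d α n r + supstar d α n s := by
  simp only [supstar, substar_eq, map_add]; ring

theorem supstar_smul (n : ℕ) (c : ℂ) (r : RatFunc ℂ) :
    supstar d α n (c • r) = RatFunc.C (conj c) * supstar d α n r := by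
  simp only [supstar, substar_eq, RatFunc.smul_eq_C_mul, map_mul, substarHom_C]; ring

theorem mem_span_succ {n : ℕ} {g : RatFunc ℂ}
    (hg : g ∈ Submodule.span ℂ (blaschke d α '' Set.Iic (n + 1))) :
    ∃ c : ℂ, ∃ g' ∈ Submodule.span ℂ (blaschke d α '' Set.Iic n),
      g = c • blaschke d α (n + 1) + g' := by
  have h : Set.Iic (n + 1) = insert (n + 1) (Set.Iic n) := by
    ext k; simp only [Set.mem_Iic, Set.mem_insert_iff]; omega
  rw [h, Set.image_insert_eq, Submodule.mem_span_insert] at hg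
  exact hg

variable (hα : ∀ n, α n ∈ domain d)
include hα

theorem supstar_blaschke_self (n : ℕ) : supstar d α n (blaschke d α n) = 1 := by
  rw [supstar, substar_eq, substarHom_blaschke hα, mul_inv_cancel₀ (blaschke_ne_zero hα n)]

theorem hasVal_supstar {n : ℕ} {g : RatFunc ℂ}
    (hg : g ∈ Submodule.span ℂ (blaschke d α '' Set.Iic n)) {z : ℂ} (hz : z ∈ domain d) :
    HasVal (supstar d α n g) z (val (supstar d α n g) z) := by
  suffices ∃ v, HasVal (supstar d α n g) z v by
    obtain ⟨v, hv⟩ := this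
    rwa [hv.val_eq]
  induction hg using Submodule.span_induction with
  | mem x hx =>
    obtain ⟨k, hk, rfl⟩ := hx
    have hk' : k ≤ n := hk
    clear hk
    induction n, hk' using Nat.le_induction with
    | base => rw [supstar_blaschke_self hα]; exact ⟨1, HasVal.one z⟩
    | succ n _ ih =>
      obtain ⟨v, hv⟩ := ih
      rw [supstar_succ]
      exact ⟨_, (hasVal_zeta (hα _) hz).mul hv⟩
  | zero => exact ⟨0, by simpa [supstar, substar_eq] using HasVal.zero z⟩
  | add x y _ _ hx hy =>
    obtain ⟨v, hv⟩ := hx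
    obtain ⟨w, hw⟩ := hy
    rw [supstar_add]
    exact ⟨_, hv.add hw⟩
  | smul c x _ hx =>
    obtain ⟨v, hv⟩ := hx
    rw [supstar_smul]
    exact ⟨_, (HasVal.C _ z).mul hv⟩

/-- At α_{n+1} the second summand vanishes, so the superstar reads off the conjugate of the leading
coefficient. -/
theorem hasVal_supstar_leading {n : ℕ} {g' : RatFunc ℂ} (c : ℂ)
    (hg' : g' ∈ Submodule.span ℂ (blaschke d α '' Set.Iic n)) {z : ℂ} (hz : z ∈ domain d) :
    HasVal (supstar d α (n + 1) (c • blaschke d α (n + 1) + g')) z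
      (conj c + val (zeta d (α (n + 1))) z * val (supstar d α n g') z) := by
  rw [supstar_add, supstar_smul, supstar_blaschke_self hα, mul_one, supstar_succ]
  exact (HasVal.C _ z).add ((hasVal_zeta (hα _) hz).mul (hasVal_supstar hα hg' hz))

/-- A rational function in the span of `B_0, …, B_n` whose substar conjugate has no poles in `𝕆`
is constant. -/
theorem eq_C_of_substar_continuousOn {n : ℕ} {g : RatFunc ℂ}
    (hg : g ∈ Submodule.span ℂ (blaschke d α '' Set.Iic n)) {e : ℂ → ℂ}
    (he : ContinuousOn e (domain d)) {s : Set ℂ} (hs : s.Finite)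
    (h : ∀ z ∈ domain d, z ∉ s → HasVal (substarHom d g) z (e z)) : ∃ c, g = RatFunc.C c := by
  induction n generalizing g with
  | zero =>
    have h0 : Set.Iic 0 = ({0} : Set ℕ) := by ext k; simp
    rw [h0, Set.image_singleton, blaschke_zero, Submodule.mem_span_singleton] at hg
    obtain ⟨c, rfl⟩ := hg
    exact ⟨c, by rw [RatFunc.smul_eq_C_mul, mul_one]⟩
  | succ n ih =>
    obtain ⟨c, g', hg', rfl⟩ := mem_span_succ hg
    have hcont : ∀ {r : RatFunc ℂ}, (∀ z ∈ domain d, HasVal r z (val r z)) →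
        ContinuousOn (val r) (domain d) := fun hr z hz =>
      (hr z hz).continuousAt.continuousWithinAt
    have hζ := hcont fun z hz => hasVal_zeta (hα (n + 1)) hz
    have hB := hcont fun z hz => (hasVal_blaschke hα (n + 1) hz).1
    have hg'c := hcont fun z hz => hasVal_supstar hα hg' hz
    -- Evaluate g^* = B_{n+1} g_* at α_{n+1} in two ways: the continuous extension of g_* makes it
    -- 0, and the leading coefficient makes it conj c. So c = 0 and the degree drops. Repeated nodes
    -- cause no trouble, since only continuity is used.
    have key := eqOn_domain (d := d) (hB.mul he)
      (continuousOn_const.add (hζ.mul hg'c)) hs (fun z hz hzs => by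
        have h1 := (hasVal_blaschke hα (n + 1) hz).1.mul (h z hz hzs)
        have h2 := hasVal_supstar_leading hα c hg' hz
        rw [supstar, substar_eq] at h2
        exact h1.unique h2) (α (n + 1)) (hα _)
    simp only [Pi.mul_apply, Pi.add_apply] at key
    have hB0 : val (blaschke d α (n + 1)) (α (n + 1)) = 0 := by
      rw [(hasVal_blaschke hα (n + 1) (hα _)).2]
      exact Finset.prod_eq_zero (Finset.mem_Icc.2 ⟨by omega, le_rfl⟩) (val_zeta_self (hα _))
    rw [hB0, val_zeta_self (hα _), zero_mul, zero_mul, add_zero] at key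
    have hc : c = 0 := by simpa using key.symm
    subst hc
    rw [zero_smul, zero_add] at h ⊢
    exact ih hg' h

end Supstar

/-! ### The combinations Ψ + FΦ and FΦ_* - Ψ_* of the candidates -/

section WallValues

variable {d : Region} {α : ℕ → ℂ} {f : ℂ → ℂ} {μ : Measure (boundary d)} [IsProbabilityMeasure μ]

/-- The values of `ϖ_0 / ϖ_a`. -/
noncomputable def ratioVal (d : Region) (a z : ℂ) : ℂ := val (varpi d (basePoint d) / varpi d a) z

/-- The denominator `S_m + ζ_{m+1} R_m^* f_{m+1}`. -/
noncomputable def wallDen (d : Region) (α : ℕ → ℂ) (f : ℂ → ℂ) (m : ℕ) (z : ℂ) : ℂ :=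
  val (wallS d α f m) z + val (zeta d (α (m + 1))) z *
    val (supstar d α m (wallR d α f m)) z * npIterate d α f (m + 1) z

/-- The cofactor of `ζ_0 B_m` in half of `Ψ_{m+1} + F Φ_{m+1}`. -/
noncomputable def wallCofactor (d : Region) (α : ℕ → ℂ) (f : ℂ → ℂ) (m : ℕ) (z : ℂ) : ℂ :=
  unimod d (α (m + 1)) / (kappa d α f (m + 1) : ℝ) * ratioVal d (α (m + 1)) z *
    upsilon d α f m / (wallDen d α f m z * (1 - omega d z * f z))

/-- The quotient of `F Φ_{m+1}^* - Ψ_{m+1}^*` by `B_{m+1}`. -/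
noncomputable def wallStarCofactor (d : Region) (α : ℕ → ℂ) (f : ℂ → ℂ) (m : ℕ) (z : ℂ) : ℂ :=
  2 / (kappa d α f (m + 1) : ℝ) * ratioVal d (α (m + 1)) z * omega d z *
    upsilon d α f m * npIterate d α f (m + 1) z / (wallDen d α f m z * (1 - omega d z * f z))

theorem hasVal_ratio {a z : ℂ} (ha : a ∈ domain d) (hz : z ∈ domain d) :
    HasVal (varpi d (basePoint d) / varpi d a) z (ratioVal d a z) ∧
    ratioVal d a z = ratioConst d a * (1 - conj (omega d a) * omega d z)⁻¹ := by
  have h : HasVal (varpi d (basePoint d) / varpi d a) z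
      (ratioConst d a * (1 - conj (omega d a) * omega d z)⁻¹) := by
    rw [one_sub_omega_mul_W ha]
    exact (HasVal.C _ z).mul ((hasVal_one_sub _ hz).inv (one_sub_conj_omega_ne ha hz))
  rw [ratioVal, h.val_eq]
  exact ⟨h, rfl⟩

variable (hα : ∀ n, α n ∈ domain d)
include hα

theorem hasVal_wallPhi (m : ℕ) {z : ℂ} (hz : z ∈ domain d) :
    HasVal (wallPhi d α f m) z (unimod d (α (m + 1)) / (kappa d α f (m + 1) : ℝ) *
      (ratioVal d (α (m + 1)) z * (omega d z * val (supstar d α m (wallS d α f m)) z -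
        val (supstar d α m (wallR d α f m)) z))) := by
  obtain ⟨-, -, vRs, vSs⟩ := hasVal_wall hα f m hz
  exact (HasVal.C _ z).mul ((hasVal_ratio (hα _) hz).1.mul (((hasVal_W hz).mul vSs).sub vRs))

theorem hasVal_wallPsi (m : ℕ) {z : ℂ} (hz : z ∈ domain d) :
    HasVal (wallPsi d α f m) z (unimod d (α (m + 1)) / (kappa d α f (m + 1) : ℝ) *
      (ratioVal d (α (m + 1)) z * (omega d z * val (supstar d α m (wallS d α f m)) z +
        val (supstar d α m (wallR d α f m)) z))) := by
  obtain ⟨-, -, vRs, vSs⟩ := hasVal_wall hα f m hz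
  exact (HasVal.C _ z).mul ((hasVal_ratio (hα _) hz).1.mul (((hasVal_W hz).mul vSs).add vRs))

theorem hasVal_supstar_wallPhi (m : ℕ) {z : ℂ} (hz : z ∈ domain d) :
    HasVal (supstar d α (m + 1) (wallPhi d α f m)) z (1 / (kappa d α f (m + 1) : ℝ) *
      (ratioVal d (α (m + 1)) z * (val (wallS d α f m) z -
        omega d z * val (wallR d α f m) z))) := by
  obtain ⟨vR, vS, -, -⟩ := hasVal_wall hα f m hz
  rw [supstar_wallPhi hα]
  exact (HasVal.C _ z).mul ((hasVal_ratio (hα _) hz).1.mul (vS.sub ((hasVal_W hz).mul vR)))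

theorem hasVal_supstar_wallPsi (m : ℕ) {z : ℂ} (hz : z ∈ domain d) :
    HasVal (supstar d α (m + 1) (wallPsi d α f m)) z (1 / (kappa d α f (m + 1) : ℝ) *
      (ratioVal d (α (m + 1)) z * (val (wallS d α f m) z +
        omega d z * val (wallR d α f m) z))) := by
  obtain ⟨vR, vS, -, -⟩ := hasVal_wall hα f m hz
  rw [supstar_wallPsi hα]
  exact (HasVal.C _ z).mul ((hasVal_ratio (hα _) hz).1.mul (vS.add ((hasVal_W hz).mul vR)))

variable (hf : IsSchurFunOf d μ f) {m : ℕ} (hm : (m : ℕ∞) < npLength d α f)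
include hf hm

theorem wallDen_ne {z : ℂ} (hz : z ∈ domain d) :
    wallDen d α f m z * (1 - omega d z * f z) ≠ 0 :=
  mul_ne_zero (wall_representation hα hf.1.1 hm hz).1 (schur_relation hf hz).1

omit [IsProbabilityMeasure μ] in
theorem continuousOn_wallDen :
    ContinuousOn (fun z => wallDen d α f m z * (1 - omega d z * f z)) (domain d) := by
  have hcont : ∀ {r : RatFunc ℂ}, (∀ z ∈ domain d, HasVal r z (val r z)) →
      ContinuousOn (val r) (domain d) := fun hr z hz =>
    (hr z hz).continuousAt.continuousWithinAt
  have h1 := hcont fun z hz => (hasVal_wall hα f m hz).2.1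
  have h2 := hcont fun z hz => (hasVal_wall hα f m hz).2.2.1
  have h3 := hcont fun z hz => hasVal_zeta (hα (m + 1)) hz
  have h4 := (differentiableOn_npIterate hα hf.1.1 (n := m + 1)
    (by exact_mod_cast Order.add_one_le_of_lt hm)).continuousOn
  exact (h1.add ((h3.mul h2).mul h4)).mul
    (continuousOn_const.sub ((continuousOn_omega d).mul hf.1.1.continuousOn))

omit hf hm [IsProbabilityMeasure μ] in
theorem continuousOn_ratioVal (n : ℕ) : ContinuousOn (ratioVal d (α n)) (domain d) :=
  fun _ hz => (hasVal_ratio (hα n) hz).1.continuousAt.continuousWithinAt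

theorem continuousOn_wallCofactor : ContinuousOn (wallCofactor d α f m) (domain d) :=
  ((continuousOn_const.mul (continuousOn_ratioVal hα _)).mul continuousOn_const).div
    (continuousOn_wallDen hα hf hm) fun _ hz => wallDen_ne hα hf hm hz

theorem continuousOn_wallStarCofactor : ContinuousOn (wallStarCofactor d α f m) (domain d) :=
  ((((continuousOn_const.mul (continuousOn_ratioVal hα _)).mul (continuousOn_omega d)).mul
    continuousOn_const).mul (differentiableOn_npIterate hα hf.1.1 (n := m + 1)
    (by exact_mod_cast Order.add_one_le_of_lt hm)).continuousOn).div
    (continuousOn_wallDen hα hf hm) fun _ hz => wallDen_ne hα hf hm hz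

/-- Inserting F = (1 + ζ_0 f)/(1 - ζ_0 f), the left side becomes a multiple of ζ_0 (S_m^* - f
R_m^*)/(1 - ζ_0 f), and interpolation supplies the factor B_m. -/
theorem wallPsi_add_cFun_mul_wallPhi {z : ℂ} (hz : z ∈ domain d) :
    val (wallPsi d α f m) z + cFun d μ z * val (wallPhi d α f m) z =
      2 * omega d z * ((∏ k ∈ Finset.Icc 1 m, val (zeta d (α k)) z) *
        wallCofactor d α f m z) := by
  have hne := wallDen_ne hα hf hm hz
  obtain ⟨h1, h2⟩ := schur_relation hf hz
  obtain ⟨h3, -⟩ := wall_interpolation hα hf.1.1 hm hz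
  rw [(hasVal_wallPsi hα m hz).val_eq, (hasVal_wallPhi hα m hz).val_eq, wallCofactor]
  rw [(hasVal_blaschke hα m hz).2] at h3
  change _ * wallDen d α f m z = _ at h3
  have hT := left_ne_zero_of_mul hne
  have hF : cFun d μ z = (1 + omega d z * f z) / (1 - omega d z * f z) := by
    rw [← h2, mul_div_cancel_right₀ _ h1]
  apply mul_left_cancel₀ hT
  generalize hX : unimod d (α (m + 1)) / ((kappa d α f (m + 1) : ℝ) : ℂ) = X
  generalize ∏ k ∈ Finset.Icc 1 m, val (zeta d (α k)) z = B at *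
  generalize wallDen d α f m z = T at *
  generalize ratioVal d (α (m + 1)) z = V at *
  generalize val (supstar d α m (wallS d α f m)) z = Ss at *
  generalize val (supstar d α m (wallR d α f m)) z = Rs at *
  generalize ((upsilon d α f m : ℝ) : ℂ) = U at *
  generalize omega d z = x at *
  generalize f z = y at *
  rw [hF]
  have h5 : 1 - x * y ≠ 0 := h1
  rw [eq_comm]
  calc T * (2 * x * (B * (X * V * U / (T * (1 - x * y)))))
      = 2 * x * X * V * (U * B) / (1 - x * y) := by field_simp
    _ = 2 * x * X * V * ((Ss - y * Rs) * T) / (1 - x * y) := by rw [h3]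
    _ = _ := by
      rw [eq_comm]
      obtain ⟨q, hq⟩ : ∃ q, q = 1 - x * y := ⟨_, rfl⟩
      rw [← hq] at h5 ⊢
      field_simp
      rw [hq]
      ring

/-- Here the numerator is ζ_0 (f S_m - R_m), which interpolation shows to be divisible by B_{m+1}.
The division cancels the poles that passing from superstar to substar creates. -/
theorem cFun_mul_substar_wallPhi_sub {z : ℂ} (hz : z ∈ domain d)
    (hz' : ∀ k ∈ Finset.Icc 1 (m + 1), z ≠ α k) :
    HasVal (substarHom d (wallPsi d α f m)) z (val (substarHom d (wallPsi d α f m)) z) ∧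
    cFun d μ z * val (substarHom d (wallPhi d α f m)) z -
      val (substarHom d (wallPsi d α f m)) z = wallStarCofactor d α f m z := by
  have hne := wallDen_ne hα hf hm hz
  obtain ⟨h1, h2⟩ := schur_relation hf hz
  obtain ⟨-, h3⟩ := wall_interpolation hα hf.1.1 hm hz
  have hB : val (blaschke d α (m + 1)) z ≠ 0 := by
    rw [(hasVal_blaschke hα (m + 1) hz).2]
    exact Finset.prod_ne_zero_iff.2 fun k hk => val_zeta_ne_zero (hα k) hz (hz' k hk)
  have hσ : ∀ r, substarHom d r = (blaschke d α (m + 1))⁻¹ * supstar d α (m + 1) r := fun r => by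
    rw [supstar, substar_eq, inv_mul_cancel_left₀ (blaschke_ne_zero hα _)]
  have v1 := ((hasVal_blaschke hα (m + 1) hz).1.inv hB).mul
    (hasVal_supstar_wallPhi (f := f) hα m hz)
  have v2 := ((hasVal_blaschke hα (m + 1) hz).1.inv hB).mul
    (hasVal_supstar_wallPsi (f := f) hα m hz)
  rw [← hσ] at v1 v2
  rw [v1.val_eq, v2.val_eq]
  refine ⟨v2, ?_⟩
  have hBs : val (blaschke d α (m + 1)) z =
      val (blaschke d α m) z * val (zeta d (α (m + 1))) z := by
    rw [blaschke_succ]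
    exact ((hasVal_blaschke hα m hz).1.mul (hasVal_zeta (hα _) hz)).val_eq
  rw [← hBs] at h3
  change _ * wallDen d α f m z = _ at h3
  have hT := left_ne_zero_of_mul hne
  have hF : cFun d μ z = (1 + omega d z * f z) / (1 - omega d z * f z) := by
    rw [← h2, mul_div_cancel_right₀ _ h1]
  rw [hF, wallStarCofactor]
  have hX : (2 : ℂ) / ((kappa d α f (m + 1) : ℝ) : ℂ) =
      2 * (1 / ((kappa d α f (m + 1) : ℝ) : ℂ)) := by ring
  rw [hX]
  generalize (1 : ℂ) / ((kappa d α f (m + 1) : ℝ) : ℂ) = X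
  generalize val (blaschke d α (m + 1)) z = B at *
  generalize wallDen d α f m z = T at *
  generalize ratioVal d (α (m + 1)) z = V at *
  generalize val (wallS d α f m) z = S at *
  generalize val (wallR d α f m) z = R at *
  generalize ((upsilon d α f m : ℝ) : ℂ) = U at *
  generalize npIterate d α f (m + 1) z = g at *
  generalize omega d z = x at *
  generalize f z = y at *
  obtain ⟨q, hq⟩ : ∃ q, q = 1 - x * y := ⟨_, rfl⟩
  rw [← hq] at h1 ⊢
  field_simp
  rw [hq]
  linear_combination (2 * x * X * V) * h3

end WallValues

/-! ### Orthogonality and norm of the candidate -/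

section Orthogonality

variable {d : Region} {α : ℕ → ℂ} {f : ℂ → ℂ} {μ : Measure (boundary d)} [IsProbabilityMeasure μ]

theorem conj_sphereVal_zeta {a : ℂ} (ha : a ∈ domain d) (t : boundary d) :
    conj (rot d a * ((bdryW t - omega d a) * (1 - conj (omega d a) * bdryW t)⁻¹)) =
      (rot d a)⁻¹ * (-conj (omega d a) + (1 - conj (omega d a) * omega d a) *
        (bdryW t - omega d a)⁻¹) := by
  have h1 := bdryW_ne_zero t
  have h2 := bdryW_sub_ne (norm_omega_lt ha) t
  have huc : conj (rot d a) = (rot d a)⁻¹ := by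
    apply eq_inv_of_mul_eq_one_left
    rw [Complex.conj_mul', norm_rot ha]; simp
  have h6 : 1 - omega d a * (bdryW t)⁻¹ = (bdryW t - omega d a) * (bdryW t)⁻¹ := by field_simp
  simp only [map_mul, map_sub, map_inv₀, map_one, conj_bdryW, huc, Complex.conj_conj, h6]
  field_simp
  ring

theorem integral_conj_zeta_mul {a : ℂ} (ha : a ∈ domain d) {G H : boundary d → ℂ}
    (hG : BddMeas G) (hH : ∀ t, H t = conj (rot d a * ((bdryW t - omega d a) *
      (1 - conj (omega d a) * bdryW t)⁻¹)) * G t) :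
    ∫ t, H t ∂μ = (rot d a)⁻¹ * (-conj (omega d a) * ∫ t, G t ∂μ +
      (1 - conj (omega d a) * omega d a) * cauchyT μ G (omega d a)) := by
  have i2 := ((BddMeas.cauchyKernel (norm_omega_lt ha)).mul hG).integrable μ
  rw [cauchyT, ← integral_const_mul, ← integral_const_mul,
    ← integral_add ((hG.integrable μ).const_mul _) (i2.const_mul _), ← integral_const_mul]
  congr 1
  funext t
  rw [hH, conj_sphereVal_zeta ha]
  ring

/-- On the boundary conj ζ_a has a simple pole at ζ_0 = ζ_0(a). Partial fractions against the Cauchy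
kernel give the transform of G at z and at a; when the latter vanishes, multiplying G by conj ζ_a
divides its transform by ζ_a(z). -/
theorem cauchyT_conj_zeta_mul {a z : ℂ} (ha : a ∈ domain d) (hz : z ∈ domain d) (hza : z ≠ a)
    {G H : boundary d → ℂ}
    (hG : BddMeas G) (hH : ∀ t, H t = conj (rot d a * ((bdryW t - omega d a) *
      (1 - conj (omega d a) * bdryW t)⁻¹)) * G t) (h0 : cauchyT μ G (omega d a) = 0) :
    val (zeta d a) z * cauchyT μ H (omega d z) = cauchyT μ G (omega d z) := by
  have i1 := ((BddMeas.cauchyKernel (norm_omega_lt hz)).mul hG).integrable μ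
  have i2 := ((BddMeas.cauchyKernel (norm_omega_lt ha)).mul hG).integrable μ
  have hxa : omega d z - omega d a ≠ 0 := sub_ne_zero.2 fun h => hza (omega_injOn d hz ha h)
  have hu : rot d a ≠ 0 := by
    intro h; have := norm_rot ha; rw [h] at this; simp at this
  have hq := one_sub_conj_omega_ne ha hz
  have hy : ∀ t : boundary d, val (zeta d a) z * ((bdryW t - omega d z)⁻¹ * H t) =
      (bdryW t - omega d z)⁻¹ * G t - (1 - conj (omega d a) * omega d a) *
        (1 - conj (omega d a) * omega d z)⁻¹ * ((bdryW t - omega d a)⁻¹ * G t) := by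
    intro t
    have h1 := bdryW_sub_ne (norm_omega_lt hz) t
    have h2 := bdryW_sub_ne (norm_omega_lt ha) t
    rw [hH, conj_sphereVal_zeta ha, val_zeta_omega ha hz]
    generalize omega d z = x at *
    generalize omega d a = b at *
    generalize bdryW t = w at *
    generalize conj b = b' at *
    obtain ⟨q, hqq⟩ : ∃ q, q = 1 - b' * x := ⟨_, rfl⟩
    rw [← hqq] at hq ⊢
    field_simp
    rw [hqq]
    ring
  rw [cauchyT, cauchyT, ← integral_const_mul]
  simp_rw [hy]
  rw [integral_sub i1 (i2.const_mul _), integral_const_mul]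
  have h3 : ∫ t : boundary d, (bdryW t - omega d a)⁻¹ * G t ∂μ = 0 := h0
  rw [h3, mul_zero, sub_zero]

variable (hα : ∀ n, α n ∈ domain d) (hf : IsSchurFunOf d μ f)
  {m : ℕ} (hm : (m : ℕ∞) < npLength d α f)
  (hL : ratSpace d α (m + 1) ≤ Submodule.span ℂ (blaschke d α '' Set.Iic (m + 1)))
include hα hf hm hL

/-- The rational function `Ψ_{m+1}` built from the Wall rational functions is the second kind
function of the corresponding `Φ_{m+1}`, and the latter is orthogonal to the constants. -/
theorem wallPsi_isSecondKindOf :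
    IsSecondKindOf α μ (m + 1) (wallPhi d α f m) (wallPsi d α f m) ∧
      ∫ t : boundary d, sphereVal (wallPhi d α f m) t ∂μ = 0 := by
  obtain ⟨P, hP⟩ := IsSecondKindOf.exists_of_mem_span (μ := μ) hα (hL (wallPhi_mem (f := f) hα m))
  set φ : boundary d → ℂ := fun t => sphereVal (wallPhi d α f m) t with hφ
  have hφb : BddMeas φ := hP.reg.2
  have hφc := hφb.conjugate
  have hE : P - wallPsi d α f m ∈ Submodule.span ℂ (blaschke d α '' Set.Iic (m + 1)) :=
    hL (Submodule.sub_mem _ hP.mem (wallPsi_mem hα m))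
  -- The substar of P - Ψ off the nodes: the two terms F Φ_* cancel, leaving minus the kernel
  -- integral of conj φ plus the cofactor, all continuous on 𝕆.
  set e : ℂ → ℂ := fun z => -(∫ t, conj (φ t) ∂μ +
    2 * omega d z * cauchyT μ (fun t => conj (φ t)) (omega d z)) + wallStarCofactor d α f m z with he
  have hec : ContinuousOn e (domain d) :=
    (continuousOn_const.add ((continuousOn_const.mul (continuousOn_omega d)).mul
      (continuousOn_cauchyT hφc))).neg.add (continuousOn_wallStarCofactor hα hf hm)
  have hs : (α '' (Finset.Icc 1 (m + 1) : Finset ℕ)).Finite := (Finset.finite_toSet _).image α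
  have hval : ∀ z ∈ domain d, z ∉ α '' (Finset.Icc 1 (m + 1) : Finset ℕ) →
      HasVal (substarHom d (P - wallPsi d α f m)) z (e z) := by
    intro z hz hzs
    have hz' : ∀ k ∈ Finset.Icc 1 (m + 1), z ≠ α k := fun k hk h =>
      hzs ⟨k, Finset.mem_coe.2 hk, h.symm⟩
    obtain ⟨h1, h2⟩ := cFun_mul_substar_wallPhi_sub hα hf hm hz hz'
    have h3 := (hP.integral_star z hz hz').sub h1
    rw [integral_kernelD_mul_sub hφc _ hz, integral_kernelD_mul hφc hz] at h3
    rw [map_sub]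
    convert h3 using 1
    simp only [he]
    linear_combination -h2
  obtain ⟨c, hc⟩ := eq_C_of_substar_continuousOn hα hE hec hs hval
  have hb := basePoint_mem d
  have h1 : e (basePoint d) = conj c := by
    refine eqOn_domain hec (continuousOn_const (c := conj c)) hs (fun z hz hzs => ?_) _ hb
    have := hval z hz hzs
    rw [hc, substarHom_C] at this
    exact this.unique (HasVal.C _ z)
  -- At α_0 both the Cauchy term and the cofactor carry the factor ζ_0 = 0.
  have h2 : e (basePoint d) = -conj (∫ t, φ t ∂μ) := by
    simp only [he, wallStarCofactor, omega_basePoint]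
    rw [integral_conj]
    simp
  -- The unstarred evaluation at α_0, where Ψ + FΦ = 0, gives the same mean with the opposite sign;
  -- hence c = 0 and the mean vanishes.
  have h3 : c = ∫ t, φ t ∂μ := by
    have h4 := (hP.integral _ hb).sub (hasVal_wallPsi (f := f) hα m hb)
    rw [hc] at h4
    have h5 := wallPsi_add_cFun_mul_wallPhi hα hf hm hb
    rw [(hasVal_wallPsi hα m hb).val_eq] at h5
    rw [(HasVal.C c _).unique h4, integral_kernelD_mul_sub hφb _ hb, integral_kernelD_mul hφb hb]
    rw [omega_basePoint] at h5 ⊢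
    linear_combination -h5
  have h6 : c = 0 := by
    have h7 : conj c = -conj c := by rw [h3, ← h2, h1, ← h3]
    have h8 : (2 : ℂ) * conj c = 0 := by linear_combination h7
    simpa using h8
  rw [h6, map_zero, sub_eq_zero] at hc
  rw [← hc, ← h3]
  exact ⟨hP, h6⟩

/-- Since Φ has mean 0, the second kind integral says that Ψ + FΦ is 2ζ_0 times this transform.
Cancelling ζ_0 is possible off α_0, and continuity fills that point. -/
theorem cauchyT_wallPhi {z : ℂ} (hz : z ∈ domain d) :
    cauchyT μ (fun t => sphereVal (wallPhi d α f m) t) (omega d z) =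
      (∏ k ∈ Finset.Icc 1 m, val (zeta d (α k)) z) * wallCofactor d α f m z := by
  obtain ⟨hP, h0⟩ := wallPsi_isSecondKindOf hα hf hm hL
  have hc : ContinuousOn (fun z => (∏ k ∈ Finset.Icc 1 m, val (zeta d (α k)) z) *
      wallCofactor d α f m z) (domain d) :=
    (continuousOn_finsetProd _ fun k _ z hz =>
      (hasVal_zeta (hα k) hz).continuousAt.continuousWithinAt).mul
      (continuousOn_wallCofactor hα hf hm)
  refine eqOn_domain (continuousOn_cauchyT hP.reg.2) hc (Set.finite_singleton (basePoint d))
    (fun z hz hzb => ?_) z hz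
  have h1 := (hP.integral z hz).val_eq
  rw [integral_kernelD_mul_sub hP.reg.2 _ hz, integral_kernelD_mul hP.reg.2 hz, h0] at h1
  have h2 := wallPsi_add_cFun_mul_wallPhi hα hf hm hz
  have h3 : omega d z ≠ 0 := fun h =>
    hzb (omega_injOn d hz (basePoint_mem d) (by rw [h, omega_basePoint]))
  apply mul_left_cancel₀ (mul_ne_zero two_ne_zero h3)
  linear_combination h2 - h1

/-- Each multiplication by conj ζ_{k+1} removes the factor ζ_{k+1} from the transform. The zero at
α_{k+1}, present as long as k < m, both permits this division and makes the next inner product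
vanish. -/
theorem cauchyT_conj_blaschke_mul_wallPhi {k : ℕ} (hk : k ≤ m) :
    (∀ z ∈ domain d, cauchyT μ (fun t => conj (sphereVal (blaschke d α k) t) *
      sphereVal (wallPhi d α f m) t) (omega d z) =
      (∏ j ∈ Finset.Icc (k + 1) m, val (zeta d (α j)) z) * wallCofactor d α f m z) ∧
    ∫ t : boundary d, conj (sphereVal (blaschke d α k) t) *
      sphereVal (wallPhi d α f m) t ∂μ = 0 := by
  obtain ⟨hP, h0⟩ := wallPsi_isSecondKindOf hα hf hm hL
  induction k with
  | zero =>
    have h1 : ∀ t : boundary d, sphereVal (blaschke d α 0) t = 1 := fun t => by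
      rw [blaschke_zero]; exact (HasSVal.one _).val_eq
    simp only [h1, map_one, one_mul, zero_add]
    exact ⟨fun z hz => cauchyT_wallPhi hα hf hm hL hz, h0⟩
  | succ k ih =>
    obtain ⟨ih1, ih2⟩ := ih (by omega)
    obtain ⟨hreg, -, hsv⟩ := bdryReg_blaschke hα k
    have hG := hreg.2.conjugate.mul hP.reg.2
    have hH : ∀ t : boundary d, conj (sphereVal (blaschke d α (k + 1)) t) *
        sphereVal (wallPhi d α f m) t = conj (rot d (α (k + 1)) *
          ((bdryW t - omega d (α (k + 1))) *
            (1 - conj (omega d (α (k + 1))) * bdryW t)⁻¹)) *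
          (conj (sphereVal (blaschke d α k) t) * sphereVal (wallPhi d α f m) t) := fun t => by
      rw [hsv, map_mul]; ring
    have hzero : cauchyT μ (fun t => conj (sphereVal (blaschke d α k) t) *
        sphereVal (wallPhi d α f m) t) (omega d (α (k + 1))) = 0 := by
      rw [ih1 _ (hα _), Finset.prod_eq_zero (Finset.mem_Icc.2 ⟨le_rfl, hk⟩)
        (val_zeta_self (hα _)), zero_mul]
    constructor
    · have hc : ContinuousOn (fun z => (∏ j ∈ Finset.Icc (k + 1 + 1) m, val (zeta d (α j)) z) *
          wallCofactor d α f m z) (domain d) :=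
        (continuousOn_finsetProd _ fun k _ z hz =>
          (hasVal_zeta (hα k) hz).continuousAt.continuousWithinAt).mul
          (continuousOn_wallCofactor hα hf hm)
      refine eqOn_domain (continuousOn_cauchyT
        ((bdryReg_blaschke hα (k + 1)).1.2.conjugate.mul hP.reg.2)) hc
        (Set.finite_singleton (α (k + 1))) (fun z hz hza => ?_)
      apply mul_left_cancel₀ (val_zeta_ne_zero (hα (k + 1)) hz hza)
      rw [cauchyT_conj_zeta_mul (hα (k + 1)) hz hza hG hH hzero, ih1 z hz,
        ← Finset.insert_Icc_add_one_left_eq_Icc hk, Finset.prod_insert (by simp), mul_assoc]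
    · rw [integral_conj_zeta_mul (hα (k + 1)) hG hH, hzero, ih2]
      simp

theorem integral_conj_mul_wallPhi_eq_zero {g : RatFunc ℂ}
    (hg : g ∈ Submodule.span ℂ (blaschke d α '' Set.Iic m)) :
    ∫ t : boundary d, conj (sphereVal g t) * sphereVal (wallPhi d α f m) t ∂μ = 0 := by
  obtain ⟨hP, -⟩ := wallPsi_isSecondKindOf hα hf hm hL
  suffices BdryReg d g ∧
    ∫ t : boundary d, conj (sphereVal g t) * sphereVal (wallPhi d α f m) t ∂μ = 0 from this.2
  induction hg using Submodule.span_induction with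
  | mem x hx =>
    obtain ⟨k, hk, rfl⟩ := hx
    exact ⟨(bdryReg_blaschke hα k).1, (cauchyT_conj_blaschke_mul_wallPhi hα hf hm hL hk).2⟩
  | zero => refine ⟨BdryReg.zero.1, ?_⟩; simp [BdryReg.zero.2]
  | add x y _ _ hx hy =>
    refine ⟨(hx.1.add hy.1).1, ?_⟩
    simp only [(hx.1.add hy.1).2, map_add, add_mul]
    rw [integral_add ((hx.1.2.conjugate.mul hP.reg.2).integrable μ)
      ((hy.1.2.conjugate.mul hP.reg.2).integrable μ), hx.2, hy.2, add_zero]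
  | smul c x _ hx =>
    refine ⟨(hx.1.smul c).1, ?_⟩
    simp only [(hx.1.smul c).2, map_mul, mul_assoc]
    rw [integral_const_mul, hx.2, mul_zero]

-- At the node ζ_{m+1} = 0, so the denominator is S_m and the representation gives R_m = f S_m. The
-- value reappears in Φ^* at the node and is thereby seen to be nonzero.
omit hL [IsProbabilityMeasure μ] in
theorem wallDen_self : wallDen d α f m (α (m + 1)) *
      (1 - omega d (α (m + 1)) * f (α (m + 1))) =
    val (wallS d α f m) (α (m + 1)) - omega d (α (m + 1)) * val (wallR d α f m) (α (m + 1)) := by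
  obtain ⟨-, h⟩ := wall_representation hα hf.1.1 hm (hα (m + 1))
  rw [val_zeta_self (hα _)] at h
  rw [wallDen, val_zeta_self (hα _)]
  linear_combination omega d (α (m + 1)) * h

/-- By orthogonality only the leading term c B_{m+1} of the first factor contributes. Removing conj
ζ_{m+1} now meets a transform with no Blaschke zeros left, so the inner product with B_{m+1} is an
explicit multiple of the cofactor at α_{m+1}. -/
theorem integral_conj_wallPhi_mul_self (hα₀ : α 0 = basePoint d) :
    ∫ t : boundary d, conj (sphereVal (wallPhi d α f m) t) *
      sphereVal (wallPhi d α f m) t ∂μ = 1 := by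
  obtain ⟨hP, -⟩ := wallPsi_isSecondKindOf hα hf hm hL
  obtain ⟨c, g', hg', hcg⟩ := mem_span_succ (hL (wallPhi_mem (f := f) hα m))
  obtain ⟨hreg, -, hsv⟩ := bdryReg_blaschke hα m
  have hreg1 := (bdryReg_blaschke hα (m + 1)).1
  have hreg' := bdryReg_of_mem_span hα hg'
  have h1 := fun t : boundary d => hcg ▸ ((hreg1.smul c).1.add hreg').2 t
  have h2 : ∀ t : boundary d, conj (sphereVal (wallPhi d α f m) t) *
      sphereVal (wallPhi d α f m) t = conj c * (conj (sphereVal (blaschke d α (m + 1)) t) *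
        sphereVal (wallPhi d α f m) t) +
        conj (sphereVal g' t) * sphereVal (wallPhi d α f m) t := fun t => by
    nth_rewrite 1 [h1 t]
    rw [(hreg1.smul c).2, map_add, map_mul]; ring
  simp_rw [h2]
  rw [integral_add (((hreg1.2.conjugate.mul hP.reg.2).integrable μ).const_mul _)
    ((hreg'.2.conjugate.mul hP.reg.2).integrable μ), integral_const_mul,
    integral_conj_mul_wallPhi_eq_zero hα hf hm hL hg', add_zero]
  have hG := hreg.2.conjugate.mul hP.reg.2
  have hH : ∀ t : boundary d, conj (sphereVal (blaschke d α (m + 1)) t) *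
      sphereVal (wallPhi d α f m) t = conj (rot d (α (m + 1)) *
        ((bdryW t - omega d (α (m + 1))) *
          (1 - conj (omega d (α (m + 1))) * bdryW t)⁻¹)) *
        (conj (sphereVal (blaschke d α m) t) * sphereVal (wallPhi d α f m) t) := fun t => by
    rw [hsv, map_mul]; ring
  obtain ⟨h3, h4⟩ := cauchyT_conj_blaschke_mul_wallPhi hα hf hm hL le_rfl
  rw [integral_conj_zeta_mul (hα (m + 1)) hG hH, h3 _ (hα _), h4]
  -- conj c is Φ^* at α_{m+1}; its factor S_m - ζ_0 R_m cancels the denominator of the cofactor,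
  -- leaving Υ_m and the constants compared in `weightRatio_eq`.
  have h5 := (hcg ▸ hasVal_supstar_leading hα c hg' (hα (m + 1))).unique
    (hasVal_supstar_wallPhi (f := f) hα m (hα (m + 1)))
  rw [val_zeta_self (hα _), zero_mul, add_zero, ← wallDen_self hα hf hm] at h5
  have hT := wallDen_ne hα hf hm (hα (m + 1))
  obtain ⟨hk, hk2⟩ := kappa_pos hα hα₀ hm
  obtain ⟨hρ, hrel⟩ := weightRatio_eq (hα (m + 1))
  have hU := upsilon_pos hα hm
  have hu : rot d (α (m + 1)) ≠ 0 := by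
    intro h; have := norm_rot (hα (m + 1)); rw [h] at this; simp at this
  rw [h5, wallCofactor, (hasVal_ratio (hα (m + 1)) (hα (m + 1))).2]
  have hq := one_sub_conj_omega_ne (hα (m + 1)) (hα (m + 1))
  have hk' : ((kappa d α f (m + 1) : ℝ) : ℂ) ≠ 0 := by exact_mod_cast hk.ne'
  have hk2' : ((kappa d α f (m + 1) : ℝ) : ℂ) ^ 2 =
      ((upsilon d α f m : ℝ) : ℂ) * ((weightRatio d (α (m + 1)) : ℝ) : ℂ) := by exact_mod_cast hk2
  have hU' : ((upsilon d α f m : ℝ) : ℂ) ≠ 0 := by exact_mod_cast hU.ne'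
  rw [Finset.Icc_eq_empty (by omega), Finset.prod_empty, one_mul, mul_zero, zero_add]
  generalize wallDen d α f m (α (m + 1)) *
      (1 - omega d (α (m + 1)) * f (α (m + 1))) = T at *
  generalize 1 - conj (omega d (α (m + 1))) * omega d (α (m + 1)) = q at *
  field_simp
  rw [hk2']
  linear_combination ((upsilon d α f m : ℝ) : ℂ) * hrel

end Orthogonality

/-! ### Identification with the given orthonormal and second kind functions -/

section Uniqueness

variable {d : Region} {α : ℕ → ℂ} {f : ℂ → ℂ} {μ : Measure (boundary d)} [IsProbabilityMeasure μ]
  {Φ Ψ : ℕ → RatFunc ℂ}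

omit [IsProbabilityMeasure μ] in
theorem IsORF.bdryReg {N : ℕ∞} (hΦ : IsORF d α μ N Φ) (hα : ∀ n, α n ∈ domain d) {n : ℕ}
    (hn : (n : ℕ∞) ≤ N) : BdryReg d (Φ n) :=
  bdryReg_of_mem_span hα (hΦ.mem_span n hn)

theorem BdryReg.sum {ι : Type*} (s : Finset ι) (c : ι → ℂ) {g : ι → RatFunc ℂ}
    (hg : ∀ i ∈ s, BdryReg d (g i)) : BdryReg d (∑ i ∈ s, c i • g i) ∧
      ∀ t : boundary d, sphereVal (∑ i ∈ s, c i • g i) t = ∑ i ∈ s, c i * sphereVal (g i) t := by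
  classical
  induction s using Finset.induction_on with
  | empty => simpa using BdryReg.zero
  | insert i s hi ih =>
    obtain ⟨h1, h2⟩ := ih fun j hj => hg j (Finset.mem_insert_of_mem hj)
    obtain ⟨h3, h4⟩ := (hg i (Finset.mem_insert_self i s)).smul (c i)
    rw [Finset.sum_insert hi]
    refine ⟨(h3.add h1).1, fun t => ?_⟩
    rw [(h3.add h1).2, h4, h2, Finset.sum_insert hi]

theorem IsORF.integral_conj_mul_sum {N : ℕ∞} (hΦ : IsORF d α μ N Φ)
    (hα : ∀ n, α n ∈ domain d) {n : ℕ} (hn : (n : ℕ∞) ≤ N) (c : Fin (n + 1) → ℂ)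
    (j : Fin (n + 1)) :
    ∫ t : boundary d, conj (sphereVal (Φ j) t) *
      sphereVal (∑ i, c i • Φ i) t ∂μ = c j := by
  have hle : ∀ i : Fin (n + 1), ((i : ℕ) : ℕ∞) ≤ N := fun i =>
    le_trans (by exact_mod_cast Nat.lt_succ_iff.1 i.2) hn
  have hreg := fun i : Fin (n + 1) => hΦ.bdryReg hα (hle i)
  obtain ⟨-, h⟩ := BdryReg.sum Finset.univ c (g := fun i : Fin (n + 1) => Φ i)
    fun i _ => hreg i
  simp_rw [h, Finset.mul_sum, mul_left_comm _ (c _)]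
  rw [integral_finsetSum _ fun i _ =>
    ((hreg j).2.conjugate.mul (hreg i).2).integrable μ |>.const_mul _]
  simp_rw [integral_const_mul, hΦ.orthonormal _ _ (hle _) (hle _), Fin.val_inj]
  simp

/-- Orthonormality makes the n + 1 functions linearly independent, so they fill a space of dimension
at most n + 1. As they lie in the Blaschke span, this also gives the inclusion on which the
orthogonality lemmas depend. -/
theorem IsORF.span_eq {N : ℕ∞} (hΦ : IsORF d α μ N Φ) (hα : ∀ n, α n ∈ domain d) {n : ℕ}
    (hn : (n : ℕ∞) ≤ N) :
    Submodule.span ℂ (Set.range fun i : Fin (n + 1) => Φ i) = ratSpace d α n ∧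
      ratSpace d α n ≤ Submodule.span ℂ (blaschke d α '' Set.Iic n) := by
  have hle : ∀ i : Fin (n + 1), ((i : ℕ) : ℕ∞) ≤ N := fun i =>
    le_trans (by exact_mod_cast Nat.lt_succ_iff.1 i.2) hn
  have h1 : Submodule.span ℂ (Set.range fun i : Fin (n + 1) => Φ i) ≤
      Submodule.span ℂ (blaschke d α '' Set.Iic n) := by
    rw [Submodule.span_le]
    rintro _ ⟨i, rfl⟩
    exact Submodule.span_mono (Set.image_mono (Set.Iic_subset_Iic.2 (Nat.lt_succ_iff.1 i.2)))
      (hΦ.mem_span i (hle i))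
  have hli : LinearIndependent ℂ fun i : Fin (n + 1) => Φ i := by
    rw [Fintype.linearIndependent_iff]
    intro c hc j
    rw [← hΦ.integral_conj_mul_sum hα hn c j, hc]
    simp [BdryReg.zero.2]
  have h2 : Submodule.span ℂ (Set.range fun i : Fin (n + 1) => Φ i) = ratSpace d α n := by
    refine Submodule.eq_of_le_of_finrank_le (h1.trans (span_blaschke_le hα n)) ?_
    rw [finrank_span_eq_card hli, Fintype.card_fin]
    exact finrank_ratSpace_le n
  exact ⟨h2, h2 ▸ h1⟩

/-- Expand the candidate in Φ_0, …, Φ_{m+1}: orthogonality kills all coefficients but the last, and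
the two unit norms make that one unimodular. -/
theorem exists_wallPhi_eq_smul (hα₀ : α 0 = basePoint d) (hα : ∀ n, α n ∈ domain d)
    (hf : IsSchurFunOf d μ f) (hΦ : IsORF d α μ (npLength d α f) Φ) {m : ℕ}
    (hm : (m : ℕ∞) < npLength d α f) :
    ∃ c : ℂ, ‖c‖ = 1 ∧ wallPhi d α f m = c • Φ (m + 1) := by
  have hn : ((m + 1 : ℕ) : ℕ∞) ≤ npLength d α f := by
    exact_mod_cast Order.add_one_le_of_lt hm
  obtain ⟨h1, hL⟩ := hΦ.span_eq hα hn
  obtain ⟨c, hc⟩ := (Submodule.mem_span_range_iff_exists_fun ℂ).1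
    (h1.symm ▸ wallPhi_mem (f := f) hα m :
      wallPhi d α f m ∈ Submodule.span ℂ (Set.range fun i : Fin (m + 1 + 1) => Φ i))
  have hz : ∀ i : Fin (m + 1), c i.castSucc = 0 := by
    intro i
    rw [← hΦ.integral_conj_mul_sum hα hn c i.castSucc, hc]
    refine integral_conj_mul_wallPhi_eq_zero hα hf hm hL ?_
    have hi : (i : ℕ) ≤ m := Nat.lt_succ_iff.1 i.2
    exact Submodule.span_mono (Set.image_mono (Set.Iic_subset_Iic.2 hi))
      (hΦ.mem_span _ (le_trans (by exact_mod_cast hi) hm.le))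
  rw [Fin.sum_univ_castSucc, Finset.sum_eq_zero (fun i _ => by rw [hz, zero_smul]), zero_add]
    at hc
  refine ⟨c (Fin.last (m + 1)), ?_, hc.symm⟩
  have h2 := integral_conj_wallPhi_mul_self hα hf hm hL hα₀
  have hreg := hΦ.bdryReg hα hn
  have hc' : wallPhi d α f m = c (Fin.last (m + 1)) • Φ (m + 1) := hc.symm
  rw [hc'] at h2
  generalize c (Fin.last (m + 1)) = b at h2
  have h3 : ∀ t : boundary d, conj (sphereVal (b • Φ (m + 1)) t) *
      sphereVal (b • Φ (m + 1)) t =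
      conj b * b * (conj (sphereVal (Φ (m + 1)) t) * sphereVal (Φ (m + 1)) t) := fun t => by
    rw [(hreg.smul b).2, map_mul]; ring
  simp_rw [h3] at h2
  rw [integral_const_mul, hΦ.orthonormal _ _ hn hn, if_pos rfl, mul_one, Complex.conj_mul'] at h2
  have h4 : ‖b‖ ^ 2 = 1 := by exact_mod_cast h2
  nlinarith [norm_nonneg b]

theorem eq_one_of_conj_mul_pos {c : ℂ} (hc : ‖c‖ = 1) {p q : ℝ} (hp : 0 < p) (hq : 0 < q)
    (h : conj c * p = q) : c = 1 := by
  have h1 : p = q := by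
    have := congrArg norm h
    rwa [norm_mul, RCLike.norm_conj, hc, one_mul, Complex.norm_of_nonneg hp.le,
      Complex.norm_of_nonneg hq.le] at this
  have hp' : (p : ℂ) ≠ 0 := by exact_mod_cast hp.ne'
  have h2 : conj c = 1 := by
    rw [← h1] at h
    exact mul_right_cancel₀ hp' (by rw [h, one_mul])
  simpa using congrArg conj h2

theorem ratioVal_mul_val_varpi {a z : ℂ} (ha : a ∈ domain d) (hz : z ∈ domain d) :
    ratioVal d a z * val (varpi d a) z = val (varpi d (basePoint d)) z := by
  have h := ((hasVal_ratio ha hz).1.mul (hasVal_varpi d a z))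
  rw [div_mul_cancel₀ _ (varpi_ne_zero ha)] at h
  exact h.val_eq.symm

/-- The increments of R and S carry the factor ζ_{k+1}, which vanishes at α_{k+1}. Thus consecutive
superstars Φ^* are comparable at the node where the normalization is imposed. -/
theorem wall_sub_at_node (hα : ∀ n, α n ∈ domain d) (f : ℂ → ℂ) (k : ℕ) :
    val (wallS d α f (k + 1)) (α (k + 1)) -
      omega d (α (k + 1)) * val (wallR d α f (k + 1)) (α (k + 1)) =
    val (wallS d α f k) (α (k + 1)) -
      omega d (α (k + 1)) * val (wallR d α f k) (α (k + 1)) := by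
  have hz := hα (k + 1)
  obtain ⟨vR, vS, vRs, vSs⟩ := hasVal_wall hα f k hz
  have hζ := hasVal_zeta hz hz
  rw [wallR_succ, wallS_succ, (vR.add (((HasVal.C _ _).mul hζ).mul vSs)).val_eq,
    (vS.add (((HasVal.C _ _).mul hζ).mul vRs)).val_eq, val_zeta_self hz]
  ring

/-- The orthonormal rational functions are the `Φ_n` built from the Wall rational functions. -/
theorem IsORF.eq_wallPhi (hα₀ : α 0 = basePoint d) (hα : ∀ n, α n ∈ domain d)
    (hf : IsSchurFunOf d μ f) (hΦ : IsORF d α μ (npLength d α f) Φ) {m : ℕ}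
    (hm : (m : ℕ∞) < npLength d α f) : Φ (m + 1) = wallPhi d α f m := by
  induction m with
  | zero =>
    obtain ⟨c, hc, hcΦ⟩ := exists_wallPhi_eq_smul hα₀ hα hf hΦ hm
    have hn : ((0 + 1 : ℕ) : ℕ∞) ≤ npLength d α f := by
      exact_mod_cast Order.add_one_le_of_lt hm
    obtain ⟨e, he, hnorm⟩ := hΦ.normalized (0 + 1) le_rfl hn
    have hL := (hΦ.span_eq hα hn).2
    have hz := hα 0
    have hv := (HasVal.C (conj c) (α 0)).mul (hasVal_supstar hα (hΦ.mem_span _ hn) hz)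
    rw [← supstar_smul, ← hcΦ] at hv
    have h1 := (hasVal_supstar_wallPhi (f := f) hα 0 hz).unique hv
    obtain ⟨hk, -⟩ := kappa_pos hα hα₀ hm
    have h2 := ratioVal_mul_val_varpi (hα (0 + 1)) hz
    have hw : val (varpi d (basePoint d)) (α 0) ≠ 0 := val_varpi_ne_zero (basePoint_mem d) hz
    have h3 : val (supstar d α 0 (Φ 0)) (α 0) = 1 := by
      rw [hΦ.zero, supstar, blaschke_zero, substar_eq, map_one, one_mul, (HasVal.one _).val_eq]
    have h4 : omega d (α 0) = 0 := by rw [hα₀, omega_basePoint]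
    have h5 : val (wallS d α f 0) (α 0) = 1 := by rw [wallS_zero, (HasVal.one _).val_eq]
    rw [h4, h5, zero_mul, sub_zero, mul_one] at h1
    simp only [Nat.add_sub_cancel] at hnorm
    rw [h3, mul_one] at hnorm
    have hbase : val (varpi d (α 0)) (α 0) = val (varpi d (basePoint d)) (α 0) := by rw [hα₀]
    rw [hbase] at hnorm
    -- At α_0 one has ζ_0 = 0, S_0 = 1 and Φ_0 = 1, so only κ_1 survives.
    have h6 : conj c * (e : ℂ) = ((1 / kappa d α f (0 + 1) : ℝ) : ℂ) := by
      apply mul_right_cancel₀ hw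
      push_cast
      rw [mul_assoc, ← hnorm, ← mul_assoc, ← h1, mul_assoc, h2]
    rw [hcΦ, eq_one_of_conj_mul_pos hc he (by positivity) h6, one_smul]
  | succ k ih =>
    have hk' : (k : ℕ∞) < npLength d α f := lt_trans (by exact_mod_cast k.lt_succ_self) hm
    specialize ih hk'
    obtain ⟨c, hc, hcΦ⟩ := exists_wallPhi_eq_smul hα₀ hα hf hΦ hm
    have hn : ((k + 1 + 1 : ℕ) : ℕ∞) ≤ npLength d α f := by
      exact_mod_cast Order.add_one_le_of_lt hm
    obtain ⟨e, he, hnorm⟩ := hΦ.normalized (k + 1 + 1) (by omega) hn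
    have hz := hα (k + 1)
    have hv := (HasVal.C (conj c) (α (k + 1))).mul (hasVal_supstar hα (hΦ.mem_span _ hn) hz)
    rw [← supstar_smul, ← hcΦ] at hv
    have h1 := (hasVal_supstar_wallPhi (f := f) hα (k + 1) hz).unique hv
    obtain ⟨hκ, -⟩ := kappa_pos hα hα₀ hm
    obtain ⟨hκ', -⟩ := kappa_pos hα hα₀ hk'
    have h2 := ratioVal_mul_val_varpi (hα (k + 1 + 1)) hz
    have h2' := ratioVal_mul_val_varpi (hα (k + 1)) hz
    have hw : val (varpi d (basePoint d)) (α (k + 1)) ≠ 0 :=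
      val_varpi_ne_zero (basePoint_mem d) hz
    have hQ := wallDen_ne hα hf hk' hz
    rw [wallDen_self hα hf hk'] at hQ
    rw [wall_sub_at_node hα] at h1
    simp only [Nat.add_sub_cancel] at hnorm
    rw [ih, (hasVal_supstar_wallPhi (f := f) hα k hz).val_eq] at hnorm
    generalize val (wallS d α f k) (α (k + 1)) -
      omega d (α (k + 1)) * val (wallR d α f k) (α (k + 1)) = Q at *
    -- Both superstars contain the same nonzero value Q and, after multiplication by their ϖ, the
    -- same ϖ_0 factor. Cancelling these leaves conj c between positive reals.
    have h6 : conj c * ((e / kappa d α f (k + 1) : ℝ) : ℂ) =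
        ((1 / kappa d α f (k + 1 + 1) : ℝ) : ℂ) := by
      apply mul_right_cancel₀ (mul_ne_zero hw hQ)
      push_cast
      linear_combination (-(val (varpi d (α (k + 1 + 1))) (α (k + 1)))) * h1 -
        conj c * hnorm + (1 / ((kappa d α f (k + 1 + 1) : ℝ) : ℂ)) * Q * h2 -
        conj c * (e : ℂ) * (1 / ((kappa d α f (k + 1) : ℝ) : ℂ)) * Q * h2'
    rw [hcΦ, eq_one_of_conj_mul_pos hc (by positivity) (by positivity) h6, one_smul]

theorem IsSecondKind.eq_wallPsi (hα₀ : α 0 = basePoint d) (hα : ∀ n, α n ∈ domain d)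
    (hf : IsSchurFunOf d μ f) (hΦ : IsORF d α μ (npLength d α f) Φ)
    (hΨ : IsSecondKind d μ (npLength d α f) Φ Ψ) {m : ℕ}
    (hm : (m : ℕ∞) < npLength d α f) : Ψ (m + 1) = wallPsi d α f m := by
  have hn : ((m + 1 : ℕ) : ℕ∞) ≤ npLength d α f := by
    exact_mod_cast Order.add_one_le_of_lt hm
  obtain ⟨hP, -⟩ := wallPsi_isSecondKindOf hα hf hm (hΦ.span_eq hα hn).2
  refine ratFunc_ext (d := d) fun z hz => ?_
  rw [hΨ.integral (m + 1) (by omega) hn z hz, (hP.integral z hz).val_eq,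
    hΦ.eq_wallPhi hα₀ hα hf hm]

end Uniqueness

end WallORF

/-! ### The eight identities -/

theorem mainTheorem8 (d : Region) (α : ℕ → ℂ) (hα₀ : α 0 = basePoint d)
    (hα : ∀ n, α n ∈ domain d)
    (f : ℂ → ℂ) (μ : Measure (boundary d)) [IsProbabilityMeasure μ] (hf : IsSchurFunOf d μ f)
    (Φ Ψ : ℕ → RatFunc ℂ) (hΦ : IsORF d α μ (npLength d α f) Φ)
    (hΨ : IsSecondKind d μ (npLength d α f) Φ Ψ)
    (n : ℕ) (hn : 1 ≤ n) (hnN : (n : ℕ∞) < npLength d α f + 1) :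
    let R := wallR d α f (n - 1)
    let S := wallS d α f (n - 1)
    let Rs := supstar d α (n - 1) R
    let Ss := supstar d α (n - 1) S
    let Φs := supstar d α n (Φ n)
    let Ψs := supstar d α n (Ψ n)
    let κ : RatFunc ℂ := RatFunc.C ((kappa d α f n : ℝ) : ℂ)
    let zn : RatFunc ℂ := RatFunc.C (unimod d (α n))
    let ϖ₀ := varpi d (α 0)
    let ϖ₀s := varpiStar (α 0)
    let ϖn := varpi d (α n)
    let ζ₀ := zeta d (α 0)
    (R = κ / 2 * (ϖn / ϖ₀s) * (Ψs - Φs) ∧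
      Rs = κ / (2 * zn) * (ϖn / ϖ₀) * (Ψ n - Φ n) ∧
      S = κ / 2 * (ϖn / ϖ₀) * (Ψs + Φs) ∧
      Ss = κ / (2 * zn) * (ϖn / ϖ₀s) * (Ψ n + Φ n)) ∧
    (Φ n = zn / κ * (ϖ₀ / ϖn) * (ζ₀ * Ss - Rs) ∧
      Φs = 1 / κ * (ϖ₀ / ϖn) * (S - ζ₀ * R) ∧
      Ψ n = zn / κ * (ϖ₀ / ϖn) * (ζ₀ * Ss + Rs) ∧
      Ψs = 1 / κ * (ϖ₀ / ϖn) * (S + ζ₀ * R)) := by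
  obtain ⟨m, rfl⟩ : ∃ m, n = m + 1 := ⟨n - 1, by omega⟩
  -- With n = m + 1, the bound n < N + 1 is exactly m < N, so f_m is strictly bounded by 1 and γ_0,
  -- …, γ_m lie in the open disk.
  have hm : (m : ℕ∞) < npLength d α f := by
    rw [Nat.cast_add, Nat.cast_one] at hnN
    exact lt_of_add_lt_add_right hnN
  intro R S Rs Ss Φs Ψs κ zn ϖ₀ ϖ₀s ϖn ζ₀
  have hϖ₀ : ϖ₀ = varpi d (basePoint d) := by simp only [ϖ₀, hα₀]
  have hϖ₀s : ϖ₀s = W d * ϖ₀ := by simp only [ϖ₀s, ϖ₀, hα₀, varpiStar_basePoint]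
  have hζ₀ : ζ₀ = W d := by simp only [ζ₀, hα₀, W]
  have hκ : κ ≠ 0 := (map_ne_zero _).2 (by exact_mod_cast (kappa_pos hα hα₀ hm).1.ne')
  have hzn : zn ≠ 0 := (map_ne_zero _).2 (unimod_ne_zero (hα _))
  have hϖ₀0 : ϖ₀ ≠ 0 := varpi_ne_zero (hα _)
  have hϖn0 : ϖn ≠ 0 := varpi_ne_zero (hα _)
  have hW := W_ne_zero d
  have e1 : Φ (m + 1) = zn / κ * (ϖ₀ / ϖn) * (W d * Ss - Rs) := by
    rw [hΦ.eq_wallPhi hα₀ hα hf hm, wallPhi, map_div₀, hϖ₀, mul_assoc]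
    rfl
  have e2 : Φs = 1 / κ * (ϖ₀ / ϖn) * (S - W d * R) := by
    change supstar d α (m + 1) (Φ (m + 1)) = _
    rw [hΦ.eq_wallPhi hα₀ hα hf hm, supstar_wallPhi hα, map_div₀, map_one, hϖ₀, mul_assoc]
    rfl
  have e3 : Ψ (m + 1) = zn / κ * (ϖ₀ / ϖn) * (W d * Ss + Rs) := by
    rw [hΨ.eq_wallPsi hα₀ hα hf hΦ hm, wallPsi, map_div₀, hϖ₀, mul_assoc]
    rfl
  have e4 : Ψs = 1 / κ * (ϖ₀ / ϖn) * (S + W d * R) := by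
    change supstar d α (m + 1) (Ψ (m + 1)) = _
    rw [hΨ.eq_wallPsi hα₀ hα hf hΦ hm, supstar_wallPsi hα, map_div₀, map_one, hϖ₀, mul_assoc]
    rfl
  -- After this substitution the converse identities are definitional; the direct ones are sums and
  -- differences of them, with ϖ*_0 = ζ_0 ϖ_0 accounting for the two different denominators.
  rw [hϖ₀s, hζ₀, e1, e2, e3, e4]
  clear_value R S Rs Ss κ zn ϖ₀ ϖn
  refine ⟨⟨?_, ?_, ?_, ?_⟩, rfl, rfl, rfl, rfl⟩ <;>
  · field_simp
    ring
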